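/- All vector spaces are over $\mathbb{C}$, and all modules and submodules are $\mathbb{Z}/2$-graded; a module is simple if it is nonzero and has no submodules other than $0$ and itself. Let $m,n\ge 0$, let $A=\mathbb{C}[t_1,\dots,t_m]\otimes\Lambda(\xi_1,\dots,\xi_n)$ with $t_i$ even and $\xi_j$ odd, and write $x_1,\dots,x_{m+n}$ for $t_1,\dots,t_m,\xi_1,\dots,\xi_n$ and $\partial_s$ for the (left) derivative $\partial/\partial x_s$. Let $W$ be the Lie superalgebra of all superderivations of $A$, and $\Delta=\mathrm{span}\{\partial_1,\dots,\partial_{m+n}\}\subset W$. An $(AW)_{m,n}$-module is a module over the Lie superalgebra $W\ltimes A$ (with $[D,f]=D(f)$ and $[f,g]=0$ for $D\in W$, $f,g\in A$) on which the action of $A$ is associative and unital. Let $\mathbf a\in\mathbb{C}^m$ and let $\phi_{\mathbf a}:\Delta\to\mathbb{C}$ be the linear map with $\phi_{\mathbf a}(\partial/\partial t_i)=a_i$ and $\phi_{\mathbf a}(\partial/\partial\xi_j)=0$. An $(AW)_{m,n}$-module $M$ is a Whittaker module of type $\mathbf a$ if $\Delta$ acts locally finitely on $M$ and for every $v\in M$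 there is $k\in\mathbb{N}$ with $(x-\phi_{\mathbf a}(x))^k v=0$ for all $x\in\Delta$. Put $\mathrm{Wh}_{\mathbf a}(M)=\{v\in M: xv=\phi_{\mathbf a}(x)v \text{ for all } x\in\Delta\}$. For a $\mathfrak{gl}(m,n)$-module $V$, let $T(A^{\mathbf a},V)$ be the superspace $A\otimes V$ with the $(AW)_{m,n}$-module structure given, for homogeneous $f,p\in A$, $v\in V$ and $1\le s\le m+n$, by $$f\cdot(p\otimes v)=fp\otimes v,$$ $$f\partial_s\cdot(p\otimes v)=f\,(\partial_s p+\phi_{\mathbf a}(\partial_s)p)\otimes v+\sum_{k=1}^{m+n}(-1)^{|x_k|(|f|-|x_k|)}(-1)^{(|x_k|+|x_s|)|p|}\,(\partial_k f)\,p\otimes E_{k,s}v,$$ where $E_{k,s}$ are the matrix units of $\mathfrak{gl}(m,n)$. **Theorem 4.5.** Let $M$ be a simple Whittaker $(AW)_{m,n}$-module of type $\mathbf a$ such that $\mathrm{Wh}_{\mathbf a}(M)$ is finite-dimensional. Then there is a finite-dimensional simple $\mathfrak{gl}(m,n)$-module $V$ such that $M\cong T(A^{\mathbf a},V)$ as $(AW)_{m,n}$-modules,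 by a parity-preserving isomorphism. -/

import Mathlib

open scoped TensorProduct

universe u

noncomputable section

namespace WittSuper

/-- The sign `(-1)^{pq}` attached to a pair of parities. -/
def sgn (p q : ZMod 2) : ℂ := (-1) ^ (p.val * q.val)

theorem sgn_comm (p q : ZMod 2) : sgn p q = sgn q p := by
  unfold sgn; rw [mul_comm]

@[simp] theorem sgn_zero_left (q : ZMod 2) : sgn 0 q = 1 := by simp [sgn]
@[simp] theorem sgn_zero_right (q : ZMod 2) : sgn q 0 = 1 := by simp [sgn]
@[simp] theorem sgn_one_one : sgn 1 1 = -1 := by simp [sgn, ZMod.val_one]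

theorem zmod_cases (p : ZMod 2) : p = 0 ∨ p = 1 := by revert p; decide

theorem one_add_one' : (1 + 1 : ZMod 2) = 0 := by decide

theorem sgn_add_left (p q r : ZMod 2) : sgn (p + q) r = sgn p r * sgn q r := by
  rcases zmod_cases p with rfl | rfl <;> rcases zmod_cases q with rfl | rfl <;>
    rcases zmod_cases r with rfl | rfl <;> simp [one_add_one']

theorem sgn_add_right (p q r : ZMod 2) : sgn p (q + r) = sgn p q * sgn p r := by
  rw [sgn_comm, sgn_add_left, sgn_comm q, sgn_comm r]

theorem sgn_mul_self (p q : ZMod 2) : sgn p q * sgn p q = 1 := by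
  rcases zmod_cases p with rfl | rfl <;> rcases zmod_cases q with rfl | rfl <;> simp

/-- The tensor product `ℂ[t_1, …, t_m] ⊗ Λ(ξ_1, …, ξ_n)` of algebras. -/
abbrev PolyExt (m n : ℕ) : Type :=
  MvPolynomial (Fin m) ℂ ⊗[ℂ] ExteriorAlgebra ℂ (Fin n → ℂ)

/-- The algebra `A = ℂ[t_1, …, t_m] ⊗ Λ(ξ_1, …, ξ_n)`. -/
def A (m n : ℕ) : Type := PolyExt m n

instance (m n : ℕ) : Ring (A m n) := inferInstanceAs (Ring (PolyExt m n))

instance (m n : ℕ) : Algebra ℂ (A m n) := inferInstanceAs (Algebra ℂ (PolyExt m n))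

variable {m n : ℕ}

/-- The element `p ⊗ e` of `A`. -/
def A.mk (p : MvPolynomial (Fin m) ℂ) (e : ExteriorAlgebra ℂ (Fin n → ℂ)) : A m n :=
  (p ⊗ₜ[ℂ] e : PolyExt m n)

/-- The linear map on `A` induced by linear maps on the two tensor factors. -/
def A.map (f : MvPolynomial (Fin m) ℂ →ₗ[ℂ] MvPolynomial (Fin m) ℂ)
    (g : ExteriorAlgebra ℂ (Fin n → ℂ) →ₗ[ℂ] ExteriorAlgebra ℂ (Fin n → ℂ)) :
    A m n →ₗ[ℂ] A m n :=
  (TensorProduct.map f g : PolyExt m n →ₗ[ℂ] PolyExt m n)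

theorem A.map_mk (f : MvPolynomial (Fin m) ℂ →ₗ[ℂ] MvPolynomial (Fin m) ℂ)
    (g : ExteriorAlgebra ℂ (Fin n → ℂ) →ₗ[ℂ] ExteriorAlgebra ℂ (Fin n → ℂ)) (p e) :
    A.map f g (A.mk p e) = A.mk (f p) (g e) := TensorProduct.map_tmul f g p e

theorem A.mk_add_left (p q : MvPolynomial (Fin m) ℂ) (e : ExteriorAlgebra ℂ (Fin n → ℂ)) :
    A.mk (p + q) e = A.mk p e + A.mk q e := TensorProduct.add_tmul p q e

theorem A.mk_add_right (p : MvPolynomial (Fin m) ℂ) (e f : ExteriorAlgebra ℂ (Fin n → ℂ)) :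
    A.mk p (e + f) = A.mk p e + A.mk p f := TensorProduct.tmul_add p e f

theorem A.mk_smul_left (c : ℂ) (p : MvPolynomial (Fin m) ℂ) (e : ExteriorAlgebra ℂ (Fin n → ℂ)) :
    A.mk (c • p) e = c • A.mk p e := TensorProduct.smul_tmul' c p e

theorem A.mk_smul_right (c : ℂ) (p : MvPolynomial (Fin m) ℂ)
    (e : ExteriorAlgebra ℂ (Fin n → ℂ)) :
    A.mk p (c • e) = c • A.mk p e := TensorProduct.tmul_smul c p e

theorem A.mk_neg_right (p : MvPolynomial (Fin m) ℂ) (e : ExteriorAlgebra ℂ (Fin n → ℂ)) :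
    A.mk p (-e) = -A.mk p e := TensorProduct.tmul_neg p e

theorem A.mk_zero_right (p : MvPolynomial (Fin m) ℂ) :
    A.mk p (0 : ExteriorAlgebra ℂ (Fin n → ℂ)) = 0 := TensorProduct.tmul_zero _ p

theorem A.mk_zero_left (e : ExteriorAlgebra ℂ (Fin n → ℂ)) :
    A.mk (0 : MvPolynomial (Fin m) ℂ) e = 0 := TensorProduct.zero_tmul _ e

theorem A.mk_sum_right {ι : Type*} (s : Finset ι) (p : MvPolynomial (Fin m) ℂ)
    (e : ι → ExteriorAlgebra ℂ (Fin n → ℂ)) :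
    A.mk p (∑ i ∈ s, e i) = ∑ i ∈ s, A.mk p (e i) := TensorProduct.tmul_sum p s e

theorem A.mk_mul (p q : MvPolynomial (Fin m) ℂ) (e f : ExteriorAlgebra ℂ (Fin n → ℂ)) :
    A.mk p e * A.mk q f = A.mk (p * q) (e * f) := Algebra.TensorProduct.tmul_mul_tmul p q e f

theorem A.mk_one : (A.mk 1 1 : A m n) = 1 := rfl

theorem A.mk_induction {P : A m n → Prop} (h0 : P 0) (hadd : ∀ x y, P x → P y → P (x + y))
    (hmk : ∀ p e, P (A.mk p e)) (x : A m n) : P x :=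
  TensorProduct.induction_on (motive := P) x h0 hmk hadd

/-- Parity of an index: `inl i` stands for the even variable `t_i`,
`inr j` for the odd variable `ξ_j`. -/
def par : Fin m ⊕ Fin n → ZMod 2 := Sum.elim (fun _ => 0) (fun _ => 1)

/-- The generators `t_i` and `ξ_j` of `A`. -/
def X : Fin m ⊕ Fin n → A m n :=
  Sum.elim (fun i => A.mk (MvPolynomial.X i) 1)
    (fun j => A.mk 1 (ExteriorAlgebra.ι ℂ (Pi.single j (1 : ℂ))))

/-- The parity automorphism of `A`: it fixes every `t_i` and sends `ξ_j` to `-ξ_j`. -/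
def gamma (m n : ℕ) : A m n →ₐ[ℂ] A m n :=
  (Algebra.TensorProduct.map (AlgHom.id ℂ (MvPolynomial (Fin m) ℂ))
    (CliffordAlgebra.involute (Q := (0 : QuadraticForm ℂ (Fin n → ℂ)))) :
    PolyExt m n →ₐ[ℂ] PolyExt m n)

theorem gamma_mk (p : MvPolynomial (Fin m) ℂ) (e : ExteriorAlgebra ℂ (Fin n → ℂ)) :
    gamma m n (A.mk p e) = A.mk p (CliffordAlgebra.involute e) :=
  Algebra.TensorProduct.map_tmul _ _ p e

/-- The partial derivatives `∂/∂t_i` and `∂/∂ξ_j` (the left odd derivation with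
`∂ξ_k/∂ξ_j = δ_{jk}`) as linear maps on `A`. -/
def pd : Fin m ⊕ Fin n → A m n →ₗ[ℂ] A m n :=
  Sum.elim
    (fun i => A.map (MvPolynomial.pderiv i).toLinearMap LinearMap.id)
    (fun j => A.map LinearMap.id
      (CliffordAlgebra.contractLeft (Q := (0 : QuadraticForm ℂ (Fin n → ℂ)))
        (LinearMap.proj j)))

theorem A_induction {P : A m n → Prop} (h1 : P 1) (hs : ∀ (c : ℂ) x, P x → P (c • x))
    (hadd : ∀ x y, P x → P y → P (x + y)) (hX : ∀ s x, P x → P (X s * x)) (x : A m n) : P x := by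
  have h0 : P 0 := by simpa using hs 0 _ h1
  have hE : ∀ e : ExteriorAlgebra ℂ (Fin n → ℂ), P (A.mk 1 e) := by
    intro e
    induction e using CliffordAlgebra.left_induction with
    | algebraMap r =>
      rw [Algebra.algebraMap_eq_smul_one, A.mk_smul_right]
      exact hs _ _ h1
    | add x y hx hy => rw [A.mk_add_right]; exact hadd _ _ hx hy
    | ι_mul x v hx =>
      have hv : v = ∑ j, v j • (Pi.single j (1 : ℂ) : Fin n → ℂ) := by
        ext k; simp [Finset.sum_apply, Pi.single_apply]
      rw [hv, map_sum, Finset.sum_mul, A.mk_sum_right]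
      refine Finset.sum_induction _ P hadd h0 ?_
      intro j _
      rw [map_smul, smul_mul_assoc, A.mk_smul_right]
      refine hs _ _ ?_
      simpa [X, A.mk_mul, ExteriorAlgebra.ι] using hX (Sum.inr j) _ hx
  induction x using A.mk_induction with
  | h0 => exact h0
  | hadd x y hx hy => exact hadd _ _ hx hy
  | hmk p e =>
    induction p using MvPolynomial.induction_on with
    | C r =>
      have : (MvPolynomial.C r : MvPolynomial (Fin m) ℂ) = r • 1 := by
        rw [MvPolynomial.smul_eq_C_mul, mul_one]
      rw [this, A.mk_smul_left]
      exact hs _ _ (hE e)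
    | add p q hp hq => rw [A.mk_add_left]; exact hadd _ _ hp hq
    | mul_X p i hp => simpa [X, A.mk_mul, mul_comm] using hX (Sum.inl i) _ hp

@[simp] theorem gamma_X (s : Fin m ⊕ Fin n) : gamma m n (X s) = (-1 : ℂ) ^ (par s).val • X s := by
  rcases s with i | j
  · simp [gamma_mk, X, par]
  · simp [gamma_mk, X, par, ExteriorAlgebra.ι, ZMod.val_one, A.mk_neg_right]

theorem gamma_gamma (x : A m n) : gamma m n (gamma m n x) = x := by
  induction x using A_induction with
  | h1 => simp
  | hs c x hx => simp [hx]
  | hadd x y hx hy => simp [hx, hy]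
  | hX s x hx =>
    rcases zmod_cases (par s) with h | h <;> simp [hx, h, ZMod.val_one]

/-- The power of the parity automorphism with exponent a parity. -/
def gam (p : ZMod 2) : A m n →ₐ[ℂ] A m n := if p = 0 then AlgHom.id ℂ _ else gamma m n

@[simp] theorem gam_zero (x : A m n) : gam 0 x = x := by simp [gam]
@[simp] theorem gam_one (x : A m n) : gam 1 x = gamma m n x := by simp [gam]

theorem gam_gam (p q : ZMod 2) (x : A m n) : gam p (gam q x) = gam (p + q) x := by
  rcases zmod_cases p with rfl | rfl <;> rcases zmod_cases q with rfl | rfl <;>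
    simp [one_add_one', gamma_gamma]

theorem gam_X (p : ZMod 2) (s : Fin m ⊕ Fin n) : gam p (X s) = sgn p (par s) • X s := by
  rcases zmod_cases p with rfl | rfl
  · simp
  · simp [sgn, ZMod.val_one]

theorem X_mul_X (s t : Fin m ⊕ Fin n) :
    (X s * X t : A m n) = sgn (par s) (par t) • (X t * X s) := by
  rcases s with i | i <;> rcases t with j | j
  · simp [X, par, A.mk_mul, mul_comm]
  · simp [X, par, A.mk_mul]
  · simp [X, par, A.mk_mul]
  · have := ExteriorAlgebra.ι_add_mul_swap (R := ℂ) (Pi.single i (1 : ℂ) : Fin n → ℂ)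
      (Pi.single j 1)
    rw [add_eq_zero_iff_eq_neg] at this
    simp [X, par, A.mk_mul, this, A.mk_neg_right]

theorem X_mul (s : Fin m ⊕ Fin n) (x : A m n) : X s * x = gam (par s) x * X s := by
  induction x using A_induction with
  | h1 => simp
  | hs c x hx => simp [hx]
  | hadd x y hx hy => simp [mul_add, add_mul, hx, hy]
  | hX t x hx =>
    rw [← mul_assoc, X_mul_X, smul_mul_assoc, mul_assoc, hx, map_mul, gam_X, smul_mul_assoc,
      smul_mul_assoc, mul_assoc]

/-- The homogeneous components of `A`: the part of parity `p` is spanned by the monomials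
`t^α ξ_I` with `|I| ≡ p` modulo 2, i.e. it is the eigenspace of the parity automorphism with
eigenvalue `(-1)^p`. -/
def APart (m n : ℕ) (p : ZMod 2) : Submodule ℂ (A m n) where
  carrier := {f | gamma m n f = (-1 : ℂ) ^ p.val • f}
  add_mem' := by
    intro f g hf hg
    simp only [Set.mem_ofPred_eq] at *
    rw [map_add, hf, hg, smul_add]
  zero_mem' := by simp
  smul_mem' := by
    intro c f hf
    simp only [Set.mem_ofPred_eq] at *
    rw [map_smul, hf, smul_comm]

theorem mem_APart {p : ZMod 2} {f : A m n} :
    f ∈ APart m n p ↔ gamma m n f = (-1 : ℂ) ^ p.val • f := Iff.rfl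

theorem gam_of_mem {p : ZMod 2} {f : A m n} (hf : f ∈ APart m n p) (q : ZMod 2) :
    gam q f = sgn q p • f := by
  rcases zmod_cases q with rfl | rfl
  · simp
  · rw [gam_one, sgn, ZMod.val_one, one_mul]
    exact hf

theorem mem_APart_of_gam {p : ZMod 2} {f : A m n} (hf : gam 1 f = sgn 1 p • f) :
    f ∈ APart m n p := by
  rw [gam_one, sgn, ZMod.val_one, one_mul] at hf
  exact hf

theorem gam_mem {p : ZMod 2} {f : A m n} (hf : f ∈ APart m n p) (q : ZMod 2) :
    gam q f ∈ APart m n p := by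
  rw [gam_of_mem hf]; exact Submodule.smul_mem _ _ hf

theorem mul_mem_APart {p q : ZMod 2} {f g : A m n} (hf : f ∈ APart m n p) (hg : g ∈ APart m n q) :
    f * g ∈ APart m n (p + q) := by
  apply mem_APart_of_gam
  rw [map_mul, gam_of_mem hf, gam_of_mem hg, sgn_add_right, smul_mul_smul_comm]

theorem X_mem (s : Fin m ⊕ Fin n) : X s ∈ APart m n (par s) := gamma_X s

theorem APart_isCompl : IsCompl (APart m n 0) (APart m n 1) := by
  constructor
  · rw [Submodule.disjoint_def]
    intro x h0 h1
    simp only [mem_APart, ZMod.val_zero, ZMod.val_one, pow_zero, one_smul, pow_one,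
      neg_smul] at h0 h1
    rw [h0] at h1
    have h2 : (2 : ℂ) • x = 0 := by
      rw [two_smul]; nth_rewrite 1 [h1]; simp
    simpa using h2
  · rw [codisjoint_iff, eq_top_iff]
    intro x _
    have : x = (1 / 2 : ℂ) • (x + gamma m n x) + (1 / 2 : ℂ) • (x - gamma m n x) := by
      rw [← smul_add, add_add_sub_cancel, ← two_smul ℂ x, smul_smul]; norm_num
    rw [this]
    refine Submodule.add_mem_sup (Submodule.smul_mem _ _ ?_) (Submodule.smul_mem _ _ ?_)
    · simp [mem_APart, gamma_gamma, add_comm]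
    · simp [mem_APart, gamma_gamma, ZMod.val_one]

theorem A_hom_induction {P : A m n → Prop} (hadd : ∀ x y, P x → P y → P (x + y))
    (hp : ∀ p, ∀ x ∈ APart m n p, P x) (x : A m n) : P x := by
  have hx : x ∈ APart m n 0 ⊔ APart m n 1 := by
    rw [APart_isCompl.sup_eq_top]; trivial
  obtain ⟨a, ha, b, hb, rfl⟩ := Submodule.mem_sup.mp hx
  exact hadd _ _ (hp _ _ ha) (hp _ _ hb)

theorem mul_hom_comm {p : ZMod 2} (f : A m n) {g : A m n} (hg : g ∈ APart m n p) :
    f * g = g * gam p f := by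
  induction f using A_induction with
  | h1 => simp
  | hs c x hx => simp [hx]
  | hadd x y hx hy => simp [mul_add, add_mul, hx, hy]
  | hX s x hx =>
    rw [mul_assoc, hx, ← mul_assoc, X_mul, gam_of_mem hg, map_mul, gam_X, sgn_comm]
    simp [mul_assoc]

theorem hom_mul_comm {p : ZMod 2} {f : A m n} (hf : f ∈ APart m n p) (g : A m n) :
    f * g = gam p g * f := by
  rw [mul_hom_comm _ hf, gam_gam]
  rcases zmod_cases p with rfl | rfl <;> simp [one_add_one']

@[simp] theorem pd_one (s : Fin m ⊕ Fin n) : pd s (1 : A m n) = 0 := by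
  rcases s with i | j
  · simp [pd, ← A.mk_one, A.map_mk, A.mk_zero_left]
  · simp [pd, ← A.mk_one, A.map_mk, A.mk_zero_right]

theorem pd_X_mul (s t : Fin m ⊕ Fin n) (x : A m n) :
    pd s (X t * x) = (if s = t then x else 0) + gam (par s) (X t) * pd s x := by
  induction x using A.mk_induction with
  | h0 => simp
  | hadd x y hx hy =>
    rw [mul_add, map_add, hx, hy, map_add, mul_add]; split_ifs <;> abel
  | hmk p e =>
    rw [gam_X]
    rcases s with i | i <;> rcases t with j | j
    · by_cases h : i = j
      · subst h
        simp [pd, X, par, A.map_mk, A.mk_mul, A.mk_add_left, add_comm]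
      · simp [pd, X, par, A.map_mk, A.mk_mul, h, Ne.symm h]
    · simp [pd, X, par, A.map_mk, A.mk_mul]
    · simp [pd, X, par, A.map_mk, A.mk_mul]
    · have := CliffordAlgebra.contractLeft_ι_mul (Q := (0 : QuadraticForm ℂ (Fin n → ℂ)))
        (d := LinearMap.proj i) (Pi.single j (1 : ℂ)) e
      by_cases h : i = j
      · subst h
        simp [pd, X, par, A.map_mk, A.mk_mul, ExteriorAlgebra.ι, this, A.mk_add_right,
          A.mk_neg_right, sub_eq_add_neg]
      · simp [pd, X, par, A.map_mk, A.mk_mul, ExteriorAlgebra.ι, this, h, A.mk_neg_right]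

@[simp] theorem pd_X (s t : Fin m ⊕ Fin n) : pd s (X t : A m n) = if s = t then 1 else 0 := by
  simpa using pd_X_mul s t (1 : A m n)

theorem pd_mul (s : Fin m ⊕ Fin n) (f g : A m n) :
    pd s (f * g) = pd s f * g + gam (par s) f * pd s g := by
  induction f using A_induction with
  | h1 => simp
  | hs c x hx => simp [hx]
  | hadd x y hx hy => simp only [add_mul, map_add, hx, hy]; abel
  | hX t x hx =>
    rw [mul_assoc, pd_X_mul, hx, pd_X_mul, map_mul]
    split_ifs <;> simp [add_mul, mul_add, mul_assoc, add_assoc]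

theorem gam_pd (p : ZMod 2) (s : Fin m ⊕ Fin n) (x : A m n) :
    gam p (pd s x) = sgn p (par s) • pd s (gam p x) := by
  induction x using A_induction with
  | h1 => simp
  | hs c x hx => simp only [map_smul, hx]; rw [smul_comm]
  | hadd x y hx hy => simp [hx, hy]
  | hX t x hx =>
    simp only [pd_X_mul, map_add, map_mul, gam_X, map_smul, hx, smul_mul_assoc, mul_smul_comm,
      smul_add, smul_smul]
    congr 1
    · by_cases h : s = t
      · subst h; simp [sgn_mul_self]
      · simp [h]
    · congr 1; ring

theorem pd_pd (s t : Fin m ⊕ Fin n) (x : A m n) :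
    pd s (pd t x) = sgn (par s) (par t) • pd t (pd s x) := by
  induction x using A_induction with
  | h1 => simp
  | hs c x hx => simp only [map_smul, hx]; rw [smul_comm]
  | hadd x y hx hy => simp [hx, hy]
  | hX u x hx =>
    simp only [pd_X_mul, map_add, gam_X, map_smul, hx, smul_mul_assoc, mul_smul_comm,
      smul_add, smul_smul]
    by_cases h : s = u <;> by_cases h' : t = u
    · subst h; subst h'
      rcases zmod_cases (par t) with h | h <;> simp [h]
    · subst h
      simp [h', sgn_comm, mul_comm]
    · subst h'
      simp [h, sgn_mul_self, mul_comm, ← mul_assoc]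
    · simp only [h, h', if_false, smul_zero, zero_add, map_zero]
      congr 1; ac_rfl

theorem pd_mem (s : Fin m ⊕ Fin n) {p : ZMod 2} {f : A m n} (hf : f ∈ APart m n p) :
    pd s f ∈ APart m n (p + par s) := by
  apply mem_APart_of_gam
  rw [gam_pd, gam_of_mem hf, map_smul, smul_smul, sgn_add_right, mul_comm]


/-- A `ℤ/2`-grading `V = V_0 ⊕ V_1` on a complex vector space. -/
class SuperSpace (V : Type*) [AddCommGroup V] [Module ℂ V] where
  /-- The homogeneous components. -/
  part : ZMod 2 → Submodule ℂ V
  isCompl : IsCompl (part 0) (part 1)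

/-- The super commutator `xy - (-1)^{pq} yx` of elements of parities `p` and `q`. -/
def sbr {R : Type*} [Ring R] [Algebra ℂ R] (p q : ZMod 2) (x y : R) : R :=
  x * y - sgn p q • (y * x)

/-- The superderivations of `A` of parity `p`: the linear maps `D` of parity `p` with
`D(fg) = D(f) g + (-1)^{p|f|} f D(g)`. -/
def WPart (m n : ℕ) (p : ZMod 2) : Submodule ℂ (Module.End ℂ (A m n)) where
  carrier := {D | (∀ q, ∀ f ∈ APart m n q, D f ∈ APart m n (p + q)) ∧
    ∀ q, ∀ f ∈ APart m n q, ∀ g, D (f * g) = D f * g + sgn p q • (f * D g)}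
  add_mem' := by
    rintro D E ⟨hD, hD'⟩ ⟨hE, hE'⟩
    refine ⟨fun q f hf => add_mem (hD q f hf) (hE q f hf), fun q f hf g => ?_⟩
    simp only [LinearMap.add_apply, hD' q f hf, hE' q f hf, add_mul, mul_add, smul_add]
    abel
  zero_mem' := ⟨fun q f _ => by simp, fun q f _ g => by simp⟩
  smul_mem' := by
    rintro c D ⟨hD, hD'⟩
    refine ⟨fun q f hf => Submodule.smul_mem _ c (hD q f hf), fun q f hf g => ?_⟩
    simp only [LinearMap.smul_apply, hD' q f hf, smul_add, smul_mul_assoc, mul_smul_comm]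
    rw [smul_comm]

/-- The Witt superalgebra: the space of all superderivations of `A`, with the super commutator
as its bracket. -/
def W (m n : ℕ) : Submodule ℂ (Module.End ℂ (A m n)) := WPart m n 0 ⊔ WPart m n 1

theorem WPart_le (p : ZMod 2) : WPart m n p ≤ W m n := by
  rcases zmod_cases p with rfl | rfl
  · exact le_sup_left
  · exact le_sup_right

theorem der_mul {p : ZMod 2} {D : Module.End ℂ (A m n)} (hD : D ∈ WPart m n p) (f g : A m n) :
    D (f * g) = D f * g + gam p f * D g := by
  induction f using A_hom_induction with
  | hadd x y hx hy => simp only [add_mul, map_add, hx, hy]; abel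
  | hp q x hx => rw [hD.2 q x hx, gam_of_mem hx, smul_mul_assoc]

theorem der_gam {p : ZMod 2} {D : Module.End ℂ (A m n)} (hD : D ∈ WPart m n p) (q : ZMod 2)
    (f : A m n) : gam q (D f) = sgn q p • D (gam q f) := by
  induction f using A_hom_induction with
  | hadd x y hx hy => simp only [map_add, hx, hy, smul_add]
  | hp r x hx =>
    rw [gam_of_mem hx, gam_of_mem (hD.1 r x hx), map_smul, smul_smul, sgn_add_right]

theorem der_mk {p : ZMod 2} {D : Module.End ℂ (A m n)}
    (h1 : ∀ q, ∀ f ∈ APart m n q, D f ∈ APart m n (p + q))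
    (h2 : ∀ f g, D (f * g) = D f * g + gam p f * D g) : D ∈ WPart m n p :=
  ⟨h1, fun q f hf g => by rw [h2, gam_of_mem hf, smul_mul_assoc]⟩

theorem pd_mem_WPart (s : Fin m ⊕ Fin n) : (pd s : Module.End ℂ (A m n)) ∈ WPart m n (par s) :=
  der_mk (fun q f hf => by rw [add_comm]; exact pd_mem s hf) (pd_mul s)

theorem sbr_mem_WPart {p q : ZMod 2} {D E : Module.End ℂ (A m n)} (hD : D ∈ WPart m n p)
    (hE : E ∈ WPart m n q) : sbr p q D E ∈ WPart m n (p + q) := by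
  refine der_mk (fun r f hf => ?_) (fun f g => ?_)
  · refine sub_mem ?_ (Submodule.smul_mem _ _ ?_)
    · rw [add_assoc]; exact hD.1 _ _ (hE.1 _ _ hf)
    · rw [add_comm p, add_assoc]; exact hE.1 _ _ (hD.1 _ _ hf)
  · simp only [sbr, LinearMap.sub_apply, Module.End.mul_apply, LinearMap.smul_apply, der_mul hD,
      der_mul hE, map_add, gam_gam, der_gam hD, der_gam hE, smul_add, sub_mul, mul_sub,
      smul_mul_assoc, mul_smul_comm, smul_smul, sgn_comm q p, sgn_mul_self, one_smul, add_comm q p]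
    abel

theorem der_one {p : ZMod 2} {D : Module.End ℂ (A m n)} (hD : D ∈ WPart m n p) : D 1 = 0 := by
  simpa using der_mul hD 1 1

theorem der_eq {p : ZMod 2} {D : Module.End ℂ (A m n)} (hD : D ∈ WPart m n p) (f : A m n) :
    D f = ∑ l, D (X l) * pd l f := by
  induction f using A_induction with
  | h1 => simp [der_one hD]
  | hs c x hx => simp [hx, Finset.smul_sum]
  | hadd x y hx hy => simp [hx, hy, mul_add, Finset.sum_add_distrib]
  | hX s x hx =>
    rw [der_mul hD, hx]
    simp only [pd_X_mul, mul_add, Finset.sum_add_distrib, Finset.mul_sum, mul_ite, mul_zero,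
      Finset.sum_ite_eq', Finset.mem_univ, if_true]
    congr 1
    refine Finset.sum_congr rfl fun l _ => ?_
    rw [← mul_assoc, ← mul_assoc, hom_mul_comm (hD.1 _ _ (X_mem l)), gam_gam]
    rcases zmod_cases (par (l : Fin m ⊕ Fin n)) with h | h <;>
      simp [h, add_assoc, one_add_one']

/-- The even (`p = 0`) and odd (`p = 1`) parts of `gl(m,n)`: block diagonal, respectively
block off-diagonal, matrices. -/
def glPart (m n : ℕ) (p : ZMod 2) : Submodule ℂ (Matrix (Fin m ⊕ Fin n) (Fin m ⊕ Fin n) ℂ) where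
  carrier := {Y | ∀ i j, par i + par j ≠ p → Y i j = 0}
  add_mem' := by
    intro Y Z hY hZ i j h
    simp [hY i j h, hZ i j h]
  zero_mem' := by intro i j _; rfl
  smul_mem' := by
    intro c Y hY i j h
    simp [hY i j h]

/-- The structure of a (`ℤ/2`-graded) module over the Lie superalgebra `gl(m,n)` on a
superspace `V`. -/
structure GlModule (m n : ℕ) (V : Type*) [AddCommGroup V] [Module ℂ V] [SuperSpace V] where
  /-- The action of matrices. -/
  act : Matrix (Fin m ⊕ Fin n) (Fin m ⊕ Fin n) ℂ →ₗ[ℂ] Module.End ℂ V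
  act_mem : ∀ {p q : ZMod 2} {Y : Matrix (Fin m ⊕ Fin n) (Fin m ⊕ Fin n) ℂ} {v : V},
    Y ∈ glPart m n p → v ∈ SuperSpace.part q → act Y v ∈ SuperSpace.part (V := V) (p + q)
  act_sbr : ∀ {p q : ZMod 2} {Y Z : Matrix (Fin m ⊕ Fin n) (Fin m ⊕ Fin n) ℂ},
    Y ∈ glPart m n p → Z ∈ glPart m n q → act (sbr p q Y Z) = sbr p q (act Y) (act Z)

/-- The structure of an `AW`-module on a superspace `M`: a (`ℤ/2`-graded) module over the Lie
superalgebra `W ⋉ A` (with `[D, f] = D(f)` and `[f, g] = 0`) on which the action of `A` is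
associative and unital. The relation for `[f, g] = 0` follows, as `A` is supercommutative. -/
structure AWModule (m n : ℕ) (M : Type*) [AddCommGroup M] [Module ℂ M] [SuperSpace M] where
  /-- The action of `A`. -/
  actA : A m n →ₐ[ℂ] Module.End ℂ M
  /-- The action of `W`. -/
  actW : W m n →ₗ[ℂ] Module.End ℂ M
  actA_mem : ∀ {p q : ZMod 2} {f : A m n} {v : M}, f ∈ APart m n p →
    v ∈ SuperSpace.part q → actA f v ∈ SuperSpace.part (V := M) (p + q)
  actW_mem : ∀ {p q : ZMod 2} {D : Module.End ℂ (A m n)} {v : M} (hD : D ∈ WPart m n p),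
    v ∈ SuperSpace.part q → actW ⟨D, WPart_le p hD⟩ v ∈ SuperSpace.part (V := M) (p + q)
  actW_sbr : ∀ {p q : ZMod 2} {D E : Module.End ℂ (A m n)} (hD : D ∈ WPart m n p)
    (hE : E ∈ WPart m n q), actW ⟨sbr p q D E, WPart_le (p + q) (sbr_mem_WPart hD hE)⟩ =
      sbr p q (actW ⟨D, WPart_le p hD⟩) (actW ⟨E, WPart_le q hE⟩)
  actW_actA : ∀ {p q : ZMod 2} {D : Module.End ℂ (A m n)} {f : A m n} (hD : D ∈ WPart m n p),
    f ∈ APart m n q → sbr p q (actW ⟨D, WPart_le p hD⟩) (actA f) = actA (D f)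

/-- The total grading on `A ⊗ V`. -/
def tensorPart (m n : ℕ) (V : Type*) [AddCommGroup V] [Module ℂ V] [SuperSpace V] (p : ZMod 2) :
    Submodule ℂ (A m n ⊗[ℂ] V) :=
  ⨆ q : ZMod 2, LinearMap.range (TensorProduct.map (APart m n q).subtype
    (SuperSpace.part (V := V) (q + p)).subtype)

section tensor

variable {V : Type*} [AddCommGroup V] [Module ℂ V] [SuperSpace V]

theorem tmul_mem_tensorPart {p q : ZMod 2} {f : A m n} {v : V} (hf : f ∈ APart m n p)
    (hv : v ∈ SuperSpace.part q) : f ⊗ₜ[ℂ] v ∈ tensorPart m n V (p + q) := by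
  have h : v ∈ SuperSpace.part (V := V) (p + (p + q)) := by
    rcases zmod_cases p with rfl | rfl <;> simpa [← add_assoc, one_add_one'] using hv
  exact Submodule.mem_iSup_of_mem p ⟨⟨f, hf⟩ ⊗ₜ ⟨v, h⟩, rfl⟩

theorem tensorPart_induction {p : ZMod 2} {P : A m n ⊗[ℂ] V → Prop} (h0 : P 0)
    (hadd : ∀ x y, P x → P y → P (x + y))
    (ht : ∀ q r f v, f ∈ APart m n q → v ∈ SuperSpace.part (V := V) r → q + r = p → P (f ⊗ₜ v))
    {x : A m n ⊗[ℂ] V} (hx : x ∈ tensorPart m n V p) : P x := by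
  refine Submodule.iSup_induction _ (motive := P) hx ?_ h0 hadd
  rintro q _ ⟨y, rfl⟩
  induction y using TensorProduct.induction_on with
  | zero => simpa using h0
  | add x y hx hy => rw [map_add]; exact hadd _ _ hx hy
  | tmul f v =>
    refine ht q (q + p) _ _ f.2 v.2 ?_
    rcases zmod_cases q with rfl | rfl <;> simp [← add_assoc, one_add_one']

theorem V_hom_induction {P : V → Prop} (hadd : ∀ x y, P x → P y → P (x + y))
    (hp : ∀ p, ∀ x ∈ SuperSpace.part (V := V) p, P x) (x : V) : P x := by
  have hx : x ∈ SuperSpace.part (V := V) 0 ⊔ SuperSpace.part 1 := by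
    rw [SuperSpace.isCompl.sup_eq_top]; trivial
  obtain ⟨a, ha, b, hb, rfl⟩ := Submodule.mem_sup.mp hx
  exact hadd _ _ (hp _ _ ha) (hp _ _ hb)

theorem tensorPart_isCompl : IsCompl (tensorPart m n V 0) (tensorPart m n V 1) := by
  constructor
  · obtain ⟨g, hg⟩ : ∃ g : V →ₗ[ℂ] V, ∀ p, ∀ v ∈ SuperSpace.part (V := V) p,
        g v = sgn 1 p • v := by
      have hc := SuperSpace.isCompl (V := V)
      refine ⟨LinearMap.ofIsCompl hc (Submodule.subtype _) (-Submodule.subtype _), ?_⟩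
      intro p v hv
      rcases zmod_cases p with rfl | rfl
      · rw [sgn_zero_right, one_smul]
        exact LinearMap.ofIsCompl_apply_left hc (⟨v, hv⟩ : SuperSpace.part (V := V) 0)
      · rw [sgn_one_one, neg_smul, one_smul]
        exact LinearMap.ofIsCompl_apply_right hc (⟨v, hv⟩ : SuperSpace.part (V := V) 1)
    have key : ∀ p, ∀ x ∈ tensorPart m n V p,
        TensorProduct.map (gam 1 : A m n →ₐ[ℂ] A m n).toLinearMap g x = sgn 1 p • x := by
      intro p x hx
      refine tensorPart_induction (P := fun x =>
        TensorProduct.map (gam 1 : A m n →ₐ[ℂ] A m n).toLinearMap g x = sgn 1 p • x)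
        (by simp) ?_ ?_ hx
      · intro x y hx hy
        rw [map_add, hx, hy, smul_add]
      · intro q r f v hf hv h
        rw [TensorProduct.map_tmul, AlgHom.toLinearMap_apply, gam_of_mem hf, hg r v hv, ← h,
          sgn_add_right, TensorProduct.smul_tmul_smul]
    rw [Submodule.disjoint_def]
    intro x h0 h1
    have e0 := key 0 x h0
    have e1 := key 1 x h1
    rw [e0] at e1
    simp only [sgn_zero_right, one_smul, sgn_one_one] at e1
    have h2 : ∀ y : A m n ⊗[ℂ] V, y = (-1 : ℂ) • y → (2 : ℂ) • y = 0 := by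
      intro y hy
      calc (2 : ℂ) • y = y + y := two_smul ℂ y
        _ = (-1 : ℂ) • y + (1 : ℂ) • y := by rw [← hy, one_smul]
        _ = 0 := by rw [← add_smul, neg_add_cancel, zero_smul]
    have h3 : (1 / 2 : ℂ) • (2 : ℂ) • x = x := by
      rw [smul_smul]; norm_num
    rw [← h3, h2 x e1, smul_zero]
  · rw [codisjoint_iff, eq_top_iff]
    intro x hx
    clear hx
    induction x using TensorProduct.induction_on with
    | zero => exact zero_mem _
    | add x y hx hy => exact add_mem hx hy
    | tmul f v =>
      induction f using A_hom_induction with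
      | hadd x y hx hy => rw [TensorProduct.add_tmul]; exact add_mem hx hy
      | hp p f hf =>
        induction v using V_hom_induction with
        | hadd x y hx hy => rw [TensorProduct.tmul_add]; exact add_mem hx hy
        | hp q v hv =>
          have := tmul_mem_tensorPart hf hv
          rcases zmod_cases (p + q) with h | h <;> rw [h] at this
          · exact Submodule.mem_sup_left this
          · exact Submodule.mem_sup_right this

instance : SuperSpace (A m n ⊗[ℂ] V) where
  part := tensorPart m n V
  isCompl := tensorPart_isCompl


/-- The coefficient `(-1)^{|x_k|(|D x_i| - |x_k|)} ∂_k (D x_i)` with which the matrix unit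
`E_{k,i}` enters the action of a vector field `D = ∑ D(x_i) ∂_i` on a tensor module. -/
def coef (k i : Fin m ⊕ Fin n) : Module.End ℂ (A m n) →ₗ[ℂ] A m n :=
  (gam (par k)).toLinearMap ∘ₗ pd k ∘ₗ LinearMap.applyₗ (X i)

theorem coef_apply (k i : Fin m ⊕ Fin n) (D : Module.End ℂ (A m n)) :
    coef k i D = gam (par k) (pd k (D (X i))) := rfl

/-- The function `∑ a_i D(t_i)`. -/
def shift (a : Fin m → ℂ) : Module.End ℂ (A m n) →ₗ[ℂ] A m n :=
  ∑ i, a i • LinearMap.applyₗ (X (Sum.inl i))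

theorem shift_apply (a : Fin m → ℂ) (D : Module.End ℂ (A m n)) :
    shift a D = ∑ i, a i • D (X (Sum.inl i)) := by
  simp [shift, LinearMap.sum_apply]

/-- The action of vector fields on `A^a`, the module obtained from `A` by replacing
`∂/∂t_i` with `∂/∂t_i + a_i`: the field `D = ∑ D(x_i) ∂_i` acts as `D + ∑ a_i D(t_i)`. -/
def twist (a : Fin m → ℂ) : Module.End ℂ (A m n) →ₗ[ℂ] Module.End ℂ (A m n) :=
  LinearMap.id + LinearMap.mul ℂ (A m n) ∘ₗ shift a

/-- The action of a vector field on `A^a ⊗ V`. For `D = f ∂_i` with `f` and `p` homogeneous,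
`D (p ⊗ v) = (D · p) ⊗ v + ∑_k (-1)^{|x_k|(|f| - |x_k|)} (-1)^{|E_{k,i}||p|} (∂_k f) p ⊗ E_{k,i} v`,
where `D · p` is the action on `A^a`. The second sign is the usual one for moving `E_{k,i}` past
`p`. -/
def tensorAct (a : Fin m → ℂ) (ρ : GlModule m n V) :
    Module.End ℂ (A m n) →ₗ[ℂ] Module.End ℂ (A m n ⊗[ℂ] V) where
  toFun D := TensorProduct.map (twist a D) LinearMap.id +
    ∑ k, ∑ i, TensorProduct.map
      (LinearMap.mulLeft ℂ (coef k i D) ∘ₗ (gam (par k + par i)).toLinearMap)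
      (ρ.act (Matrix.single k i 1))
  map_add' D E := by
    have : ∀ x y : A m n, LinearMap.mulLeft ℂ (x + y) =
        LinearMap.mulLeft ℂ x + LinearMap.mulLeft ℂ y := fun x y => by
      ext z; simp [add_mul]
    simp only [map_add, this, LinearMap.add_comp, TensorProduct.map_add_left,
      Finset.sum_add_distrib]
    abel
  map_smul' c D := by
    have : ∀ x : A m n, LinearMap.mulLeft ℂ (c • x) = c • LinearMap.mulLeft ℂ x := fun x => by
      ext z; simp
    simp only [map_smul, this, LinearMap.smul_comp, TensorProduct.map_smul_left,
      smul_add, Finset.smul_sum, RingHom.id_apply]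

theorem tensorAct_tmul (a : Fin m → ℂ) (ρ : GlModule m n V) (D : Module.End ℂ (A m n))
    (f : A m n) (v : V) : tensorAct a ρ D (f ⊗ₜ v) = (D f + shift a D * f) ⊗ₜ v +
      ∑ k, ∑ i, (coef k i D * gam (par k + par i) f) ⊗ₜ ρ.act (Matrix.single k i 1) v := by
  simp [tensorAct, twist, LinearMap.sum_apply]

theorem shift_mem (a : Fin m → ℂ) {d : ZMod 2} {D : Module.End ℂ (A m n)}
    (hD : D ∈ WPart m n d) : shift a D ∈ APart m n d := by
  rw [shift_apply]
  refine sum_mem fun i _ => Submodule.smul_mem _ _ ?_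
  simpa [par] using hD.1 _ _ (X_mem (Sum.inl i))

theorem coef_mem (k i : Fin m ⊕ Fin n) {d : ZMod 2} {D : Module.End ℂ (A m n)}
    (hD : D ∈ WPart m n d) : coef k i D ∈ APart m n (d + (par k + par i)) := by
  rw [coef_apply]
  have := gam_mem (pd_mem k (hD.1 _ _ (X_mem i))) (par k)
  rwa [add_assoc, add_comm (par i)] at this

theorem single_mem (k i : Fin m ⊕ Fin n) :
    Matrix.single k i (1 : ℂ) ∈ glPart m n (par k + par i) := by
  intro j l h
  rw [Matrix.single_apply]
  refine if_neg ?_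
  rintro ⟨rfl, rfl⟩
  exact h rfl

theorem tensorAct_mem (a : Fin m → ℂ) (ρ : GlModule m n V) {d p : ZMod 2}
    {D : Module.End ℂ (A m n)} {x : A m n ⊗[ℂ] V} (hD : D ∈ WPart m n d)
    (hx : x ∈ tensorPart m n V p) : tensorAct a ρ D x ∈ tensorPart m n V (d + p) := by
  refine tensorPart_induction (P := fun x => tensorAct a ρ D x ∈ tensorPart m n V (d + p))
    (by simp) ?_ ?_ hx
  · intro x y hx hy
    rw [map_add]; exact add_mem hx hy
  · rintro q r f v hf hv rfl
    rw [tensorAct_tmul]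
    refine add_mem ?_ (sum_mem fun k _ => sum_mem fun i _ => ?_)
    · rw [← add_assoc]
      exact tmul_mem_tensorPart (add_mem (hD.1 _ _ hf) (mul_mem_APart (shift_mem a hD) hf)) hv
    · have := tmul_mem_tensorPart
        (mul_mem_APart (coef_mem k i hD) (gam_mem hf (par k + par i)))
        (ρ.act_mem (single_mem k i) hv)
      convert this using 2
      have h2 : (par k + par i) + (par k + par i) = 0 := by
        rcases zmod_cases (par k + par i) with h | h <;> rw [h] <;> decide
      calc d + (q + r) = d + q + r + 0 := by ring
        _ = _ := by rw [← h2]; ring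

theorem tensorAct_smul (a : Fin m → ℂ) (ρ : GlModule m n V) {d : ZMod 2}
    {D : Module.End ℂ (A m n)} (hD : D ∈ WPart m n d) (f : A m n) (x : A m n ⊗[ℂ] V) :
    tensorAct a ρ D (f • x) = D f • x + gam d f • tensorAct a ρ D x := by
  induction x using TensorProduct.induction_on with
  | zero => simp
  | add x y hx hy => simp only [smul_add, map_add, hx, hy]; abel
  | tmul g v =>
    simp only [TensorProduct.smul_tmul', smul_eq_mul, tensorAct_tmul, smul_add, Finset.smul_sum]
    rw [← add_assoc, ← TensorProduct.add_tmul]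
    congr 1
    · congr 1
      rw [der_mul hD, mul_add, ← mul_assoc, hom_mul_comm (shift_mem a hD), add_assoc, mul_assoc]
    · refine Finset.sum_congr rfl fun k _ => Finset.sum_congr rfl fun i _ => ?_
      rw [map_mul, ← mul_assoc, hom_mul_comm (coef_mem k i hD), gam_gam, mul_assoc]
      congr 3
      rcases zmod_cases (par k + par i) with h | h <;>
        simp [h, add_assoc, one_add_one']

theorem coef_comp (k i : Fin m ⊕ Fin n) {d : ZMod 2} {D : Module.End ℂ (A m n)}
    (hD : D ∈ WPart m n d) (E : Module.End ℂ (A m n)) :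
    coef k i (D * E) = ∑ j, coef k j D * gam (par k + par j) (coef j i E) + D (coef k i E) := by
  simp only [coef_apply, Module.End.mul_apply]
  rw [der_eq hD (E (X i)), der_eq hD (gam _ _), map_sum, map_sum, ← Finset.sum_add_distrib]
  refine Finset.sum_congr rfl fun j _ => ?_
  rw [pd_mul, map_add, map_mul, map_mul, gam_gam, gam_gam]
  have h2 : ∀ p : ZMod 2, p + p = 0 := by decide
  congr 1
  · rw [add_assoc, h2, add_zero]
  · rw [h2, gam_zero, pd_pd, map_smul, gam_pd, smul_smul, sgn_mul_self, one_smul]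

theorem coef_swap (l j k i : Fin m ⊕ Fin n) {d : ZMod 2} {D : Module.End ℂ (A m n)}
    (hD : D ∈ WPart m n d) (E : Module.End ℂ (A m n)) :
    gam d (coef k i E) * coef l j D = coef l j D * gam (par l + par j) (coef k i E) := by
  rw [hom_mul_comm (coef_mem l j hD), gam_gam]
  have h2 : ∀ p : ZMod 2, p + p = 0 := by decide
  rw [add_assoc, h2, add_zero]

theorem coef_swap' (l j k i : Fin m ⊕ Fin n) {d e : ZMod 2} {D E : Module.End ℂ (A m n)}
    (hD : D ∈ WPart m n d) (hE : E ∈ WPart m n e) :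
    sgn d e • (gam e (coef l j D) * coef k i E) =
      sgn (par l + par j) (par k + par i) • (gam d (coef k i E) * coef l j D) := by
  rw [coef_swap l j k i hD E, gam_of_mem (coef_mem l j hD), gam_of_mem (coef_mem k i hE),
    smul_mul_assoc, mul_smul_comm, smul_smul, smul_smul]
  congr 1
  have h1 : ∀ a b c d : ZMod 2, sgn d c * sgn c (d + a) = sgn a b * (sgn a (c + b)) := by
    intro a b c d
    rw [sgn_add_right, sgn_add_right, sgn_comm d c, ← mul_assoc, sgn_mul_self, one_mul,
      mul_comm (sgn a c), ← mul_assoc, sgn_mul_self, one_mul, sgn_comm]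
  exact h1 _ _ _ _

theorem act_sbr_single (ρ : GlModule m n V) (l j k i : Fin m ⊕ Fin n) (v : V) :
    ρ.act (Matrix.single l j 1) (ρ.act (Matrix.single k i 1) v) +
      sgn (par l + par j) (par k + par i) • (if i = l then ρ.act (Matrix.single k j 1) v else 0) =
    (if j = k then ρ.act (Matrix.single l i 1) v else 0) +
      sgn (par l + par j) (par k + par i) •
        ρ.act (Matrix.single k i 1) (ρ.act (Matrix.single l j 1) v) := by
  have h := congrArg (fun φ : Module.End ℂ V => φ v) (ρ.act_sbr (single_mem l j) (single_mem k i))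
  have hm : ∀ a b c d : Fin m ⊕ Fin n, Matrix.single a b (1 : ℂ) * Matrix.single c d (1 : ℂ) =
      if b = c then Matrix.single a d 1 else 0 := by
    intro a b c d
    split_ifs with hbc
    · subst hbc; simp
    · exact Matrix.single_mul_single_of_ne _ _ _ _ hbc _
  simp only [sbr, hm, map_sub, map_smul, LinearMap.sub_apply, LinearMap.smul_apply,
    Module.End.mul_apply] at h
  have e1 : ∀ (P : Prop) [Decidable P] (a b : Fin m ⊕ Fin n),
      ρ.act (if P then Matrix.single a b 1 else 0) v =
        if P then ρ.act (Matrix.single a b 1) v else 0 := by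
    intro P _ a b; split_ifs <;> simp
  rw [e1, e1] at h
  rw [sub_eq_sub_iff_add_eq_add] at h
  rw [h.symm]

theorem tensorAct_one_tmul (a : Fin m → ℂ) (ρ : GlModule m n V) {d : ZMod 2}
    {D : Module.End ℂ (A m n)} (hD : D ∈ WPart m n d) (v : V) :
    tensorAct a ρ D (1 ⊗ₜ v) = shift a D ⊗ₜ v +
      ∑ k, ∑ i, coef k i D ⊗ₜ ρ.act (Matrix.single k i 1) v := by
  simp [tensorAct_tmul, der_one hD]

/-- The quadratic part of the composite of two actions. -/
def quad (ρ : GlModule m n V) (d : ZMod 2) (D E : Module.End ℂ (A m n)) (v : V) :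
    A m n ⊗[ℂ] V :=
  ∑ k, ∑ i, ∑ l, ∑ j, (gam d (coef k i E) * coef l j D) ⊗ₜ
    ρ.act (Matrix.single l j 1) (ρ.act (Matrix.single k i 1) v)

theorem tensorAct_tensorAct (a : Fin m → ℂ) (ρ : GlModule m n V) {d e : ZMod 2}
    {D E : Module.End ℂ (A m n)} (hD : D ∈ WPart m n d) (hE : E ∈ WPart m n e) (v : V) :
    tensorAct a ρ D (tensorAct a ρ E (1 ⊗ₜ v)) =
      shift a (D * E) ⊗ₜ v + (gam d (shift a E) * shift a D) ⊗ₜ v +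
      (∑ k, ∑ i, (gam d (shift a E) * coef k i D) ⊗ₜ ρ.act (Matrix.single k i 1) v +
       ∑ k, ∑ i, (shift a D * coef k i E) ⊗ₜ ρ.act (Matrix.single k i 1) v) +
      ∑ k, ∑ i, D (coef k i E) ⊗ₜ ρ.act (Matrix.single k i 1) v + quad ρ d D E v := by
  have h1 : ∀ (f : A m n) (w : V), f ⊗ₜ[ℂ] w = f • ((1 : A m n) ⊗ₜ[ℂ] w) := by
    intro f w; rw [TensorProduct.smul_tmul', smul_eq_mul, mul_one]
  have h2 : ∀ (f : A m n) (w : V), tensorAct a ρ D (f ⊗ₜ w) = D f ⊗ₜ w +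
      (gam d f * shift a D) ⊗ₜ w +
      ∑ l, ∑ j, (gam d f * coef l j D) ⊗ₜ ρ.act (Matrix.single l j 1) w := by
    intro f w
    rw [h1 f w, tensorAct_smul a ρ hD, tensorAct_one_tmul a ρ hD]
    simp only [smul_add, Finset.smul_sum, TensorProduct.smul_tmul', smul_eq_mul, mul_one,
      add_assoc]
  rw [tensorAct_one_tmul a ρ hE, map_add, map_sum]
  simp only [map_sum, h2, Finset.sum_add_distrib, quad]
  have h3 : D (shift a E) = shift a (D * E) := by
    simp [shift_apply]
  have h4 : ∀ k i, gam d (coef k i E) * shift a D = shift a D * coef k i E := fun k i =>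
    (hom_mul_comm (shift_mem a hD) _).symm
  simp only [h3, h4]
  abel

theorem quad_swap (ρ : GlModule m n V) {d e : ZMod 2}
    {D E : Module.End ℂ (A m n)} (hD : D ∈ WPart m n d) (hE : E ∈ WPart m n e) (v : V) :
    quad ρ d D E v + sgn d e • ∑ k, ∑ i, (∑ j, coef k j E * gam (par k + par j) (coef j i D)) ⊗ₜ
        ρ.act (Matrix.single k i 1) v =
      ∑ k, ∑ i, (∑ j, coef k j D * gam (par k + par j) (coef j i E)) ⊗ₜ
        ρ.act (Matrix.single k i 1) v + sgn d e • quad ρ e E D v := by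
  have hL : quad ρ d D E v + sgn d e • ∑ k, ∑ i,
        (∑ j, coef k j E * gam (par k + par j) (coef j i D)) ⊗ₜ ρ.act (Matrix.single k i 1) v =
      ∑ k, ∑ i, ∑ l, ∑ j, (gam d (coef k i E) * coef l j D) ⊗ₜ
        (ρ.act (Matrix.single l j 1) (ρ.act (Matrix.single k i 1) v) +
          sgn (par l + par j) (par k + par i) •
            (if i = l then ρ.act (Matrix.single k j 1) v else 0)) := by
    simp only [TensorProduct.tmul_add, Finset.sum_add_distrib]
    congr 1
    simp only [Finset.smul_sum, TensorProduct.sum_tmul]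
    refine Finset.sum_congr rfl fun k _ => ?_
    rw [Finset.sum_comm]
    refine Finset.sum_congr rfl fun i _ => ?_
    rw [Finset.sum_comm]
    refine Finset.sum_congr rfl fun j _ => ?_
    rw [Finset.sum_eq_single i]
    · rw [if_pos rfl, ← TensorProduct.smul_tmul, ← coef_swap' i j k i hD hE,
        coef_swap k i i j hE D, TensorProduct.smul_tmul']
    · intro l _ h
      rw [if_neg (Ne.symm h), smul_zero, TensorProduct.tmul_zero]
    · intro h; exact absurd (Finset.mem_univ _) h
  have hR : ∑ k, ∑ i, (∑ j, coef k j D * gam (par k + par j) (coef j i E)) ⊗ₜ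
        ρ.act (Matrix.single k i 1) v + sgn d e • quad ρ e E D v =
      ∑ k, ∑ i, ∑ l, ∑ j, (gam d (coef k i E) * coef l j D) ⊗ₜ
        ((if j = k then ρ.act (Matrix.single l i 1) v else 0) +
      sgn (par l + par j) (par k + par i) •
        ρ.act (Matrix.single k i 1) (ρ.act (Matrix.single l j 1) v)) := by
    simp only [TensorProduct.tmul_add, Finset.sum_add_distrib]
    congr 1
    · simp only [TensorProduct.sum_tmul]
      rw [Finset.sum_comm]
      conv_rhs => rw [Finset.sum_comm]
      refine Finset.sum_congr rfl fun i _ => ?_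
      rw [Finset.sum_comm]
      refine Finset.sum_congr rfl fun k _ => ?_
      refine Finset.sum_congr rfl fun l _ => ?_
      rw [Finset.sum_eq_single k]
      · rw [if_pos rfl, coef_swap l k k i hD E]
      · intro j _ h
        rw [if_neg h, TensorProduct.tmul_zero]
      · intro h; exact absurd (Finset.mem_univ _) h
    · simp only [quad, Finset.smul_sum]
      have key : ∀ l j k i : Fin m ⊕ Fin n,
          sgn d e • (gam e (coef l j D) * coef k i E) ⊗ₜ[ℂ]
            ρ.act (Matrix.single k i 1) (ρ.act (Matrix.single l j 1) v) =
          (gam d (coef k i E) * coef l j D) ⊗ₜ[ℂ] (sgn (par l + par j) (par k + par i) •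
            ρ.act (Matrix.single k i 1) (ρ.act (Matrix.single l j 1) v)) := by
        intro l j k i
        rw [← TensorProduct.smul_tmul, ← coef_swap' l j k i hD hE, TensorProduct.smul_tmul']
      simp only [key]
      calc _ = ∑ l, ∑ k, ∑ j, ∑ i, (gam d (coef k i E) * coef l j D) ⊗ₜ[ℂ]
            (sgn (par l + par j) (par k + par i) •
            ρ.act (Matrix.single k i 1) (ρ.act (Matrix.single l j 1) v)) :=
            Finset.sum_congr rfl fun l _ => Finset.sum_comm
        _ = ∑ k, ∑ l, ∑ i, ∑ j, (gam d (coef k i E) * coef l j D) ⊗ₜ[ℂ]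
            (sgn (par l + par j) (par k + par i) •
            ρ.act (Matrix.single k i 1) (ρ.act (Matrix.single l j 1) v)) := by
            rw [Finset.sum_comm]
            exact Finset.sum_congr rfl fun k _ => Finset.sum_congr rfl fun l _ =>
              Finset.sum_comm
        _ = _ := Finset.sum_congr rfl fun k _ => Finset.sum_comm
  rw [hL, hR]
  simp only [act_sbr_single]

theorem comm_aux {G : Type*} [AddCommGroup G] [Module ℂ G] {s : ℂ} (hs : s * s = 1)
    {S1 B P Q T1 q1 R S2 T2 q2 U1 U2 : G} (e1 : R + s • (S2 + (U2 + T2)) = S1 + (U1 + T1))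
    (hq : q1 + s • U2 = U1 + s • q2) :
    S1 + B + (s • P + Q) + T1 + q1 = R + s • (S2 + s • B + (s • Q + P) + T2 + q2) := by
  simp only [smul_add, smul_smul, hs, one_smul] at *
  linear_combination (norm := module) hq - e1

theorem tensorAct_comm_one (a : Fin m → ℂ) (ρ : GlModule m n V) {d e : ZMod 2}
    {D E : Module.End ℂ (A m n)} (hD : D ∈ WPart m n d) (hE : E ∈ WPart m n e) (v : V) :
    tensorAct a ρ D (tensorAct a ρ E (1 ⊗ₜ v)) =
      tensorAct a ρ (sbr d e D E) (1 ⊗ₜ v) +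
        sgn d e • tensorAct a ρ E (tensorAct a ρ D (1 ⊗ₜ v)) := by
  have hq := quad_swap ρ hD hE v
  have e1 : tensorAct a ρ (sbr d e D E) (1 ⊗ₜ v) +
      sgn d e • (shift a (E * D) ⊗ₜ[ℂ] v + ∑ k, ∑ i, coef k i (E * D) ⊗ₜ[ℂ]
        ρ.act (Matrix.single k i 1) v) =
      shift a (D * E) ⊗ₜ[ℂ] v + ∑ k, ∑ i, coef k i (D * E) ⊗ₜ[ℂ]
        ρ.act (Matrix.single k i 1) v := by
    have h3 : D * E = sbr d e D E + sgn d e • (E * D) := by simp [sbr]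
    conv_rhs => rw [h3]
    rw [tensorAct_one_tmul a ρ (sbr_mem_WPart hD hE)]
    simp only [map_add, map_smul, TensorProduct.add_tmul, ← TensorProduct.smul_tmul', smul_add,
      Finset.smul_sum, Finset.sum_add_distrib]
    abel
  have c1 : ∀ k i, gam d (shift a E) * coef k i D = sgn d e • (shift a E * coef k i D) := by
    intro k i; rw [gam_of_mem (shift_mem a hE), smul_mul_assoc]
  have c2 : ∀ k i, gam e (shift a D) * coef k i E = sgn d e • (shift a D * coef k i E) := by
    intro k i; rw [gam_of_mem (shift_mem a hD), smul_mul_assoc, sgn_comm]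
  have c3 : gam d (shift a E) * shift a D = shift a D * shift a E :=
    (hom_mul_comm (shift_mem a hD) _).symm
  have c4 : gam e (shift a D) * shift a E = sgn d e • (shift a D * shift a E) := by
    rw [gam_of_mem (shift_mem a hD), smul_mul_assoc, sgn_comm]
  rw [tensorAct_tensorAct a ρ hD hE, tensorAct_tensorAct a ρ hE hD]
  simp only [coef_comp _ _ hD, coef_comp _ _ hE, TensorProduct.add_tmul,
    Finset.sum_add_distrib] at e1
  simp only [c1, c2, c3, c4, ← TensorProduct.smul_tmul', ← Finset.smul_sum]
  exact comm_aux (sgn_mul_self d e) e1 hq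

theorem tensorAct_comm (a : Fin m → ℂ) (ρ : GlModule m n V) {d e : ZMod 2}
    {D E : Module.End ℂ (A m n)} (hD : D ∈ WPart m n d) (hE : E ∈ WPart m n e)
    (x : A m n ⊗[ℂ] V) :
    tensorAct a ρ D (tensorAct a ρ E x) =
      tensorAct a ρ (sbr d e D E) x + sgn d e • tensorAct a ρ E (tensorAct a ρ D x) := by
  induction x using TensorProduct.induction_on with
  | zero => simp
  | add x y hx hy => simp only [map_add, hx, hy, smul_add]; abel
  | tmul f v =>
    have h1 : f ⊗ₜ[ℂ] v = f • ((1 : A m n) ⊗ₜ[ℂ] v) := by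
      rw [TensorProduct.smul_tmul', smul_eq_mul, mul_one]
    rw [h1]
    simp only [tensorAct_smul a ρ hD, tensorAct_smul a ρ hE,
      tensorAct_smul a ρ (sbr_mem_WPart hD hE), map_add, smul_add,
      tensorAct_comm_one a ρ hD hE v]
    have h2 : sgn d e • E (gam d f) = gam d (E f) := (der_gam hE d f).symm
    have h3 : D (gam e f) = sgn d e • gam e (D f) := by
      rw [der_gam hD, smul_smul, sgn_comm e d, sgn_mul_self, one_smul]
    have h4 : D (E f) = sbr d e D E f + sgn d e • E (D f) := by simp [sbr]
    simp only [← smul_assoc, h2, h3, h4, gam_gam, add_comm e d, add_smul]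
    rw [smul_comm (gam (d + e) f) (sgn d e), smul_assoc (sgn d e) (gam (d + e) f)]
    abel

/-- The tensor module `T(A^a, V) = A^a ⊗ V`; functions act by `f (p ⊗ v) = (f p) ⊗ v`. -/
def tensorModule (a : Fin m → ℂ) (ρ : GlModule m n V) : AWModule m n (A m n ⊗[ℂ] V) where
  actA := Algebra.lsmul ℂ ℂ (A m n ⊗[ℂ] V)
  actW := tensorAct a ρ ∘ₗ (W m n).subtype
  actA_mem := by
    intro p q f x hf hx
    refine tensorPart_induction (P := fun x => f • x ∈ tensorPart m n V (p + q))
      (by simp) ?_ ?_ hx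
    · intro x y hx hy
      rw [smul_add]; exact add_mem hx hy
    · rintro q r g v hg hv rfl
      rw [TensorProduct.smul_tmul', ← add_assoc]
      exact tmul_mem_tensorPart (mul_mem_APart hf hg) hv
  actW_mem := fun hD hx => tensorAct_mem a ρ hD hx
  actW_sbr := by
    intro p q D E hD hE
    refine LinearMap.ext fun x => ?_
    exact eq_sub_of_add_eq (tensorAct_comm a ρ hD hE x).symm
  actW_actA := by
    intro p q D f hD hf
    refine LinearMap.ext fun x => ?_
    have := tensorAct_smul a ρ hD f x
    rw [gam_of_mem hf, smul_assoc] at this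
    exact sub_eq_of_eq_add this

end tensor

/-- A subspace is graded if it is the sum of its intersections with the homogeneous components. -/
def IsGraded {V : Type*} [AddCommGroup V] [Module ℂ V] [SuperSpace V] (N : Submodule ℂ V) : Prop :=
  N = (N ⊓ SuperSpace.part 0) ⊔ (N ⊓ SuperSpace.part 1)

/-- A `gl(m,n)`-module is simple if it is nonzero and its only submodules (graded invariant
subspaces) are zero and the whole module. -/
def GlModule.IsSimple {V : Type*} [AddCommGroup V] [Module ℂ V] [SuperSpace V]
    (ρ : GlModule m n V) : Prop :=
  Nontrivial V ∧ ∀ N : Submodule ℂ V, IsGraded N → (∀ Y, ∀ v ∈ N, ρ.act Y v ∈ N) →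
    N = ⊥ ∨ N = ⊤

section AWModule

variable {M : Type*} [AddCommGroup M] [Module ℂ M] [SuperSpace M]

/-- An `AW`-module is simple if it is nonzero and its only submodules (graded invariant
subspaces) are zero and the whole module. -/
def AWModule.IsSimple (𝓜 : AWModule m n M) : Prop :=
  Nontrivial M ∧ ∀ N : Submodule ℂ M, IsGraded N → (∀ f, ∀ v ∈ N, 𝓜.actA f v ∈ N) →
    (∀ D, ∀ v ∈ N, 𝓜.actW D v ∈ N) → N = ⊥ ∨ N = ⊤

/-- The element `∑ c_s ∂_s` of the subalgebra `Δ` spanned by all partial derivatives. -/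
def delta (c : Fin m ⊕ Fin n → ℂ) : W m n :=
  ⟨∑ s, c s • pd s, sum_mem fun s _ =>
    Submodule.smul_mem _ _ (WPart_le (par s) (pd_mem_WPart s))⟩

/-- The value at `∑ c_s ∂_s` of the character `φ_a` of `Δ` with `φ_a(∂/∂t_i) = a_i` and
`φ_a(∂/∂ξ_j) = 0`. -/
def phi (a : Fin m → ℂ) (c : Fin m ⊕ Fin n → ℂ) : ℂ := ∑ i, c (Sum.inl i) * a i

/-- Whittaker modules: `Δ` acts locally finitely, i.e. every vector lies in a finite-dimensional
`Δ`-invariant subspace. -/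
def AWModule.IsWhittaker (𝓜 : AWModule m n M) : Prop :=
  ∀ v : M, ∃ N : Submodule ℂ M, FiniteDimensional ℂ N ∧ v ∈ N ∧
    ∀ c, ∀ w ∈ N, 𝓜.actW (delta c) w ∈ N

/-- The module is of type `a`: for every `v` there is `k` with `(x - φ_a(x))^k v = 0` for all
`x` in `Δ`. -/
def AWModule.IsOfType (a : Fin m → ℂ) (𝓜 : AWModule m n M) : Prop :=
  ∀ v : M, ∃ k : ℕ, ∀ c, ((𝓜.actW (delta c) - phi a c • (1 : Module.End ℂ M)) ^ k) v = 0

/-- The space `Wh_a(M)` of Whittaker vectors: those `v` with `x v = φ_a(x) v` for all `x`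
in `Δ`. -/
def AWModule.Wh (a : Fin m → ℂ) (𝓜 : AWModule m n M) : Submodule ℂ M where
  carrier := {v | ∀ c, 𝓜.actW (delta c) v = phi a c • v}
  add_mem' := by
    intro v w hv hw c
    rw [map_add, hv c, hw c, smul_add]
  zero_mem' := by intro c; simp
  smul_mem' := by
    intro r v hv c
    rw [map_smul, hv c, smul_comm]

/-- Two `AW`-modules are isomorphic: there is a parity-preserving linear isomorphism that commutes
with the actions of `A` and of `W`. -/
def AWModule.IsIsomorphic {N : Type*} [AddCommGroup N] [Module ℂ N] [SuperSpace N]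
    (𝓜 : AWModule m n M) (𝓝 : AWModule m n N) : Prop :=
  ∃ e : M ≃ₗ[ℂ] N, (∀ p v, v ∈ SuperSpace.part p ↔ e v ∈ SuperSpace.part (V := N) p) ∧
    (∀ f v, e (𝓜.actA f v) = 𝓝.actA f (e v)) ∧ (∀ D v, e (𝓜.actW D v) = 𝓝.actW D (e v))

end AWModule

end WittSuper

end

noncomputable section

namespace WittSuper

variable {m n : ℕ}

/-! Write `P_s` for `∂_s - φ_a(∂_s)` acting on `M`, and `𝔪` for the augmentation ideal of `A`.

The module is free over `A` on its Whittaker vectors. The `P_s` commute up to sign and are locally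
nilpotent, hence jointly so, and they satisfy the Leibniz rule over `A`. The operator `∑ x_s P_s`
acts as the scalar `k` on the `k`-th layer of the filtration by iterated joint kernels. Dividing by
`k ≥ 1` shows that `M` is generated over `A` by its Whittaker vectors (`mem_gen_Wh`). Conversely,
the kernel of `A ⊗ Wh_a(M) → M` is stable under the locally nilpotent operators `∂_s ⊗ 1`, whose
joint kernel `1 ⊗ Wh_a(M)` maps injectively (`mulMap_injective`).

So `Wh_a(M)` is identified with the fibre `M/𝔪M`; the map `π` in `IsFiberMap` is the resulting
projection. Vector fields vanishing at the origin preserve `𝔪M` and act on this fibre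
(`actW_apply`). The linear ones form a copy of `gl(m,n)`, and `V` is the fibre with this action. The
tensor module formula says that fields vanishing to second order act on the fibre by zero, so this
has to be proved; the Whittaker vectors killed in this way are called singular.

Finite-dimensionality gives a nonzero singular vector: the Euler field acts on the fibre, and a
field whose coefficient has degree `j + 2` raises its eigenvalue by `j + 1`, so an eigenvector whose
eigenvalue has largest real part is singular (`singular_ne_bot`). Singular vectors form a graded
subspace stable under `gl(m,n)`. On them the action of any field is determined by its first-order
part (`actW_field_singular`): both sides of the formula agree on the fibre, and an induction with
the `P_t` makes their difference a Whittaker vector. Hence the `A`-span of the singular vectors is a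
submodule. By simplicity it is all of `M`, and applying `π` shows that every Whittaker vector is
singular (`singular_eq_Wh`). The formula then makes multiplication `A ⊗ V → M` equivariant, and a
`gl(m,n)`-submodule of `V` generates a submodule of `M`, so `V` is simple. -/

theorem zmod_add_self (p : ZMod 2) : p + p = 0 := by revert p; decide

/-! ### The augmentation and the Euler operator of `A` -/

/-- The augmentation of `A`: the algebra map killing every `t_i` and every `ξ_j`. -/
def eps : A m n →ₐ[ℂ] ℂ :=
  (Algebra.TensorProduct.lift (MvPolynomial.aeval 0) ExteriorAlgebra.algebraMapInv
    (fun _ _ => Commute.all _ _) : PolyExt m n →ₐ[ℂ] ℂ)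

theorem eps_mk (p : MvPolynomial (Fin m) ℂ) (e : ExteriorAlgebra ℂ (Fin n → ℂ)) :
    eps (A.mk p e) = MvPolynomial.aeval (0 : Fin m → ℂ) p * ExteriorAlgebra.algebraMapInv e :=
  Algebra.TensorProduct.lift_tmul _ _ _ p e

@[simp] theorem eps_X (s : Fin m ⊕ Fin n) : eps (X s) = 0 := by
  rcases s with i | j
  · simp [X, eps_mk]
  · simp [X, eps_mk, ExteriorAlgebra.algebraMapInv]

theorem eps_gam (p : ZMod 2) (f : A m n) : eps (gam p f) = eps f := by
  induction f using A_induction with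
  | h1 => simp
  | hs c x hx => simp [hx]
  | hadd x y hx hy => simp [hx, hy]
  | hX s x hx => simp [gam_X]

/-- The augmentation is invariant under the parity automorphism, which negates odd elements. -/
theorem eps_odd {f : A m n} (hf : f ∈ APart m n 1) : eps f = 0 := by
  have h := eps_gam 1 f
  rw [gam_of_mem hf, sgn_one_one, map_smul, smul_eq_mul] at h
  linear_combination (-1 / 2 : ℂ) * h

/-- The vector field `f ∂_s`. -/
def fieldEnd (s : Fin m ⊕ Fin n) : A m n →ₗ[ℂ] Module.End ℂ (A m n) where
  toFun f := LinearMap.mulLeft ℂ f ∘ₗ pd s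
  map_add' f g := by ext x; simp [add_mul]
  map_smul' c f := by ext x; simp

@[simp] theorem fieldEnd_apply (s : Fin m ⊕ Fin n) (f g : A m n) :
    fieldEnd s f g = f * pd s g := rfl

theorem fieldEnd_one (s : Fin m ⊕ Fin n) : fieldEnd s (1 : A m n) = pd s := by
  ext x; simp

theorem fieldEnd_mem_WPart (s : Fin m ⊕ Fin n) {p : ZMod 2} {f : A m n} (hf : f ∈ APart m n p) :
    fieldEnd s f ∈ WPart m n (p + par s) := by
  refine der_mk (fun q g hg => ?_) (fun g h => ?_)
  · rw [add_assoc, add_comm (par s)]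
    exact mul_mem_APart hf (pd_mem s hg)
  · simp only [fieldEnd_apply, pd_mul, mul_add, mul_assoc]
    rw [← gam_gam, ← mul_assoc f (gam _ g), hom_mul_comm hf (gam _ g), mul_assoc (gam p _)]

theorem fieldEnd_mem_W (s : Fin m ⊕ Fin n) (f : A m n) : fieldEnd s f ∈ W m n := by
  induction f using A_hom_induction with
  | hadd x y hx hy => rw [map_add]; exact add_mem hx hy
  | hp p x hx => exact WPart_le _ (fieldEnd_mem_WPart s hx)

/-- The vector field `f ∂_s` as an element of `W`. -/
def field (s : Fin m ⊕ Fin n) : A m n →ₗ[ℂ] W m n :=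
  (fieldEnd s).codRestrict (W m n) (fieldEnd_mem_W s)

@[simp] theorem coe_field (s : Fin m ⊕ Fin n) (f : A m n) :
    (field s f : Module.End ℂ (A m n)) = fieldEnd s f := rfl

theorem W_induction {P : W m n → Prop} (hadd : ∀ x y, P x → P y → P (x + y))
    (hp : ∀ p D, ∀ hD : D ∈ WPart m n p, P ⟨D, WPart_le p hD⟩) (D : W m n) : P D := by
  obtain ⟨x, hx, y, hy, hxy⟩ := Submodule.mem_sup.mp D.2
  have : D = ⟨x, WPart_le 0 hx⟩ + ⟨y, WPart_le 1 hy⟩ := Subtype.ext hxy.symm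
  rw [this]
  exact hadd _ _ (hp _ _ hx) (hp _ _ hy)

/-- A superderivation is determined by its values on the generators. This reduces statements about
`W` to fields `f ∂_s`. -/
theorem W_eq_sum_field (D : W m n) : D = ∑ s, field s ((D : Module.End ℂ (A m n)) (X s)) := by
  induction D using W_induction with
  | hadd x y hx hy =>
    conv_lhs => rw [hx, hy]
    simp [Finset.sum_add_distrib]
  | hp p D hD =>
    refine Subtype.ext (LinearMap.ext fun f => ?_)
    rw [AddSubmonoidClass.coe_finsetSum, LinearMap.sum_apply]
    exact der_eq hD f

/-- The partial derivatives supercommute, so only the coefficient gets differentiated. This drives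
the induction on the coefficient in `actW_field_singular`. -/
theorem sbr_pd_fieldEnd (t s : Fin m ⊕ Fin n) {p : ZMod 2} {f : A m n} (hf : f ∈ APart m n p) :
    sbr (par t) (p + par s) (pd t) (fieldEnd s f) = fieldEnd s (pd t f) := by
  ext g
  simp only [sbr, LinearMap.sub_apply, Module.End.mul_apply, fieldEnd_apply, LinearMap.smul_apply,
    pd_mul, gam_of_mem hf]
  rw [pd_pd t s, sgn_add_right, smul_mul_assoc, mul_smul_comm, smul_smul, add_sub_cancel_right]

/-- The Euler operator `∑ x_s ∂_s` on `A`. -/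
def euler : Module.End ℂ (A m n) := ∑ s, fieldEnd s (X s)

theorem euler_apply (f : A m n) : euler f = ∑ s, X s * pd s f := by
  simp [euler, LinearMap.sum_apply]

theorem fieldEnd_X_mem_WPart (s t : Fin m ⊕ Fin n) :
    fieldEnd s (X t : A m n) ∈ WPart m n (par t + par s) :=
  fieldEnd_mem_WPart s (X_mem t)

theorem euler_mem_WPart : (euler : Module.End ℂ (A m n)) ∈ WPart m n 0 := by
  refine sum_mem fun s _ => ?_
  rw [← zmod_add_self (par s)]
  exact fieldEnd_X_mem_WPart s s

theorem euler_mul (f g : A m n) : euler (f * g) = euler f * g + f * euler g := by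
  simpa using der_mul euler_mem_WPart f g

@[simp] theorem euler_X (s : Fin m ⊕ Fin n) : euler (X s : A m n) = X s := by
  simp [euler_apply]

theorem pd_euler (s : Fin m ⊕ Fin n) (f : A m n) : pd s (euler f) = pd s f + euler (pd s f) := by
  simp only [euler_apply, map_sum, pd_X_mul, Finset.sum_add_distrib, Finset.sum_ite_eq,
    Finset.mem_univ, if_true]
  congr 1
  refine Finset.sum_congr rfl fun t _ => ?_
  rw [gam_X, pd_pd, smul_mul_smul_comm, sgn_mul_self, one_smul]

/-- A coefficient of degree `c + 1` gives a field of degree `c`, since `∂_s` lowers degree by one.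
-/
theorem euler_comm_fieldEnd (s : Fin m ⊕ Fin n) {f : A m n} {c : ℂ}
    (hf : euler f = (c + 1) • f) :
    euler * fieldEnd s f - fieldEnd s f * euler = c • fieldEnd s f := by
  ext g
  simp only [LinearMap.sub_apply, Module.End.mul_apply, fieldEnd_apply, LinearMap.smul_apply,
    euler_mul, pd_euler, hf, mul_add, add_mul, smul_mul_assoc, add_smul, one_smul]
  abel

/-- `f` minus its constant term is a sum of homogeneous elements of positive degree. -/
theorem sub_eps_mem_span (f : A m n) :
    f - eps f • 1 ∈ Submodule.span ℂ {g : A m n | ∃ j : ℕ, euler g = ((j : ℂ) + 1) • g} := by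
  induction f using A_induction with
  | h1 => simp
  | hs c x hx =>
    rw [map_smul, smul_assoc, ← smul_sub]
    exact Submodule.smul_mem _ _ hx
  | hadd x y hx hy =>
    rw [map_add, add_smul, add_sub_add_comm]
    exact add_mem hx hy
  | hX s x hx =>
    have h1 : X s ∈ Submodule.span ℂ {g : A m n | ∃ j : ℕ, euler g = ((j : ℂ) + 1) • g} :=
      Submodule.subset_span ⟨0, by simp⟩
    have h2 : ∀ y ∈ Submodule.span ℂ {g : A m n | ∃ j : ℕ, euler g = ((j : ℂ) + 1) • g},
        X s * y ∈ Submodule.span ℂ {g : A m n | ∃ j : ℕ, euler g = ((j : ℂ) + 1) • g} := by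
      intro y hy
      induction hy using Submodule.span_induction with
      | mem y hy =>
        obtain ⟨j, hj⟩ := hy
        refine Submodule.subset_span ⟨j + 1, ?_⟩
        rw [euler_mul, euler_X, hj, mul_smul_comm]
        push_cast
        module
      | zero => simp
      | add y z _ _ hy hz => rw [mul_add]; exact add_mem hy hz
      | smul c y _ hy => rw [mul_smul_comm]; exact Submodule.smul_mem _ _ hy
    have h3 : X s * x = X s * (x - eps x • 1) + eps x • X s := by
      rw [mul_sub, mul_smul_comm, mul_one, sub_add_cancel]
    rw [map_mul, eps_X, zero_mul, zero_smul, sub_zero, h3]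
    exact add_mem (h2 _ hx) (Submodule.smul_mem _ _ h1)

theorem span_homogeneous :
    Submodule.span ℂ {g : A m n | ∃ j : ℕ, euler g = (j : ℂ) • g} = ⊤ := by
  rw [eq_top_iff]
  intro f _
  have h1 : (1 : A m n) ∈ Submodule.span ℂ {g : A m n | ∃ j : ℕ, euler g = (j : ℂ) • g} :=
    Submodule.subset_span ⟨0, by simp [euler_apply]⟩
  have h2 : Submodule.span ℂ {g : A m n | ∃ j : ℕ, euler g = ((j : ℂ) + 1) • g} ≤
      Submodule.span ℂ {g : A m n | ∃ j : ℕ, euler g = (j : ℂ) • g} := by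
    refine Submodule.span_mono ?_
    rintro g ⟨j, hj⟩
    exact ⟨j + 1, by simpa using hj⟩
  rw [← sub_add_cancel f (eps f • 1)]
  exact add_mem (h2 (sub_eps_mem_span f)) (Submodule.smul_mem _ _ h1)

/-- `A` is spanned by `1`, the generators, and the multiples of products of two generators. -/
theorem A_induction_two {P : A m n → Prop} (h1 : P 1) (hX : ∀ s, P (X s))
    (hs : ∀ (c : ℂ) x, P x → P (c • x)) (hadd : ∀ x y, P x → P y → P (x + y))
    (hXX : ∀ s t x, P (X s * (X t * x))) (x : A m n) : P x := by
  suffices h : P x ∧ ∀ s, P (X s * x) from h.1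
  induction x using A_induction with
  | h1 => exact ⟨h1, fun s => by simpa using hX s⟩
  | hs c x hx => exact ⟨hs c x hx.1, fun s => by rw [mul_smul_comm]; exact hs c _ (hx.2 s)⟩
  | hadd x y hx hy =>
    exact ⟨hadd _ _ hx.1 hy.1, fun s => by rw [mul_add]; exact hadd _ _ (hx.2 s) (hy.2 s)⟩
  | hX t x hx => exact ⟨hx.2 t, fun s => hXX s t x⟩

/-! ### Iterated joint kernels of a family of operators -/

/-- The vectors killed by all words of length `k` in the operators `D_s`. -/
def killed {ι M : Type*} [AddCommGroup M] [Module ℂ M] (D : ι → Module.End ℂ M) :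
    ℕ → Submodule ℂ M
  | 0 => ⊥
  | k + 1 => ⨅ s, (killed D k).comap (D s)

theorem mem_killed_succ {ι M : Type*} [AddCommGroup M] [Module ℂ M] {D : ι → Module.End ℂ M}
    {k : ℕ} {v : M} : v ∈ killed D (k + 1) ↔ ∀ s, D s v ∈ killed D k := by
  simp [killed]

theorem killed_mono {ι M : Type*} [AddCommGroup M] [Module ℂ M] (D : ι → Module.End ℂ M) :
    Monotone (killed D) := by
  refine monotone_nat_of_le_succ fun k => ?_
  induction k with
  | zero => exact bot_le
  | succ k ih => exact fun v hv => mem_killed_succ.2 fun s => ih (mem_killed_succ.1 hv s)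

/-- Pairwise commuting up to sign, locally nilpotent operators are jointly locally nilpotent. -/
theorem exists_mem_killed {ι M : Type*} [Fintype ι] [DecidableEq ι] [AddCommGroup M] [Module ℂ M]
    {D : ι → Module.End ℂ M}
    (hcomm : ∀ s t, ∃ c : ℂ, ∀ v, D s (D t v) = c • D t (D s v))
    {v : M} {r : ι → ℕ} (hv : ∀ s, (D s ^ r s) v = 0) : ∃ k, v ∈ killed D k := by
  have hpow : ∀ s t k, ∃ c : ℂ, ∀ v, (D s ^ k) (D t v) = c • D t ((D s ^ k) v) := by
    intro s t k
    obtain ⟨c, hc⟩ := hcomm s t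
    induction k with
    | zero => exact ⟨1, by simp⟩
    | succ k ih =>
      obtain ⟨d, hd⟩ := ih
      refine ⟨d * c, fun v => ?_⟩
      rw [pow_succ', Module.End.mul_apply, Module.End.mul_apply, hd, map_smul, hc, smul_smul]
  -- Induct on the total exponent. Applying `D_s` lowers `r s` by one and keeps the other exponents
  -- valid, because `D_t ^ r t` passes through `D_s` up to a scalar. A word of length one more than
  -- the sum of the `r s` therefore kills `v`.
  suffices h : ∀ (k : ℕ) (r : ι → ℕ) (v : M), ∑ s, r s = k → (∀ s, (D s ^ r s) v = 0) →
      v ∈ killed D (k + 1) from ⟨_, h _ r v rfl hv⟩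
  intro k
  induction k with
  | zero =>
    intro r v hr hv
    refine mem_killed_succ.2 fun s => ?_
    have h0 : r s = 0 := (Finset.sum_eq_zero_iff.1 hr) s (Finset.mem_univ s)
    have h1 := hv s
    rw [h0, pow_zero, Module.End.one_apply] at h1
    simp [h1]
  | succ k ih =>
    intro r v hr hv
    refine mem_killed_succ.2 fun s => ?_
    rcases Nat.eq_zero_or_pos (r s) with h0 | h0
    · have h1 := hv s
      rw [h0, pow_zero, Module.End.one_apply] at h1
      simp [h1]
    · refine ih (Function.update r s (r s - 1)) _ ?_ fun t => ?_
      · rw [Finset.sum_update_of_mem (Finset.mem_univ s)]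
        have h2 := Finset.add_sum_erase Finset.univ r (Finset.mem_univ s)
        rw [Finset.sdiff_singleton_eq_erase]
        omega
      · by_cases hts : t = s
        · subst hts
          rw [Function.update_self, ← Module.End.mul_apply, ← pow_succ,
            Nat.sub_add_cancel h0]
          exact hv t
        · obtain ⟨c, hc⟩ := hpow t s (r t)
          rw [Function.update_of_ne hts, hc, hv t, map_zero, smul_zero]

/-! ### The operators `∂_s ⊗ 1` on `A ⊗ V` -/

section tensorKernel

variable {V : Type*} [AddCommGroup V] [Module ℂ V]

/-- By the Leibniz rule, multiplication by a generator costs at most one further derivative. -/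
theorem A_mem_killed (f : A m n) : ∃ k, f ∈ killed (pd (m := m) (n := n)) k := by
  induction f using A_induction with
  | h1 => exact ⟨1, mem_killed_succ.2 fun s => by simp⟩
  | hs c x hx => exact hx.imp fun k hk => Submodule.smul_mem _ _ hk
  | hadd x y hx hy =>
    obtain ⟨k, hk⟩ := hx
    obtain ⟨l, hl⟩ := hy
    exact ⟨max k l, add_mem (killed_mono _ (le_max_left k l) hk)
      (killed_mono _ (le_max_right k l) hl)⟩
  | hX t x hx =>
    obtain ⟨k, hk⟩ := hx
    refine ⟨k + 1, ?_⟩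
    induction k generalizing x with
    | zero =>
      have : x = 0 := by simpa [killed] using hk
      simp [this]
    | succ k ih =>
      refine mem_killed_succ.2 fun s => ?_
      rw [pd_X_mul, gam_X, smul_mul_assoc]
      refine add_mem ?_ (Submodule.smul_mem _ _ (ih _ (mem_killed_succ.1 hk s)))
      split_ifs
      · exact hk
      · exact zero_mem _

variable (V) in
/-- The operator `∂_s ⊗ 1` on `A ⊗ V`. -/
def pdTensor (s : Fin m ⊕ Fin n) : Module.End ℂ (A m n ⊗[ℂ] V) := (pd s).rTensor V

theorem tensor_mem_killed (x : A m n ⊗[ℂ] V) :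
    ∃ k, x ∈ killed (pdTensor (m := m) (n := n) V) k := by
  induction x using TensorProduct.induction_on with
  | zero => exact ⟨0, zero_mem _⟩
  | add x y hx hy =>
    obtain ⟨k, hk⟩ := hx
    obtain ⟨l, hl⟩ := hy
    exact ⟨max k l, add_mem (killed_mono _ (le_max_left k l) hk)
      (killed_mono _ (le_max_right k l) hl)⟩
  | tmul f v =>
    obtain ⟨k, hk⟩ := A_mem_killed f
    refine ⟨k, ?_⟩
    induction k generalizing f with
    | zero =>
      have : f = 0 := by simpa [killed] using hk
      simp [this]
    | succ k ih =>
      refine mem_killed_succ.2 fun s => ?_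
      rw [pdTensor, LinearMap.rTensor_tmul]
      exact ih _ (mem_killed_succ.1 hk s)

/-- The joint kernel of the operators `∂_s ⊗ 1` is `1 ⊗ V`. -/
theorem exists_eq_one_tmul {x : A m n ⊗[ℂ] V} (hx : ∀ s, pdTensor V s x = 0) :
    ∃ v : V, x = 1 ⊗ₜ v := by
  -- The element `x` lies in the `0`-eigenspace of the Euler operator `E`. Any element is some `1 ⊗
  -- v` plus a sum of eigenvectors with nonzero eigenvalues; as `1 ⊗ v` also has eigenvalue `0`,
  -- independence of eigenspaces forces `x = 1 ⊗ v`.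
  set E : Module.End ℂ (A m n ⊗[ℂ] V) := euler.rTensor V with hE
  have hE0 : E x = 0 := by
    have h : E = ∑ s, (LinearMap.mulLeft ℂ (X s : A m n)).rTensor V ∘ₗ pdTensor V s := by
      refine TensorProduct.ext' fun f v => ?_
      simp only [hE, LinearMap.rTensor_tmul, euler_apply, LinearMap.sum_apply, LinearMap.comp_apply,
        pdTensor, LinearMap.mulLeft_apply, TensorProduct.sum_tmul]
    simp [h, LinearMap.sum_apply, hx]
  have key : ∀ y : A m n ⊗[ℂ] V, ∃ v : V,
      y - 1 ⊗ₜ v ∈ ⨆ μ : ℂ, ⨆ _ : μ ≠ 0, E.eigenspace μ := by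
    intro y
    induction y using TensorProduct.induction_on with
    | zero => exact ⟨0, by simp⟩
    | add x y hx hy =>
      obtain ⟨v, hv⟩ := hx
      obtain ⟨w, hw⟩ := hy
      refine ⟨v + w, ?_⟩
      rw [TensorProduct.tmul_add, add_sub_add_comm]
      exact add_mem hv hw
    | tmul f v =>
      refine ⟨eps f • v, ?_⟩
      rw [← TensorProduct.smul_tmul, ← TensorProduct.sub_tmul]
      have hf := sub_eps_mem_span f
      generalize f - eps f • 1 = g at hf
      induction hf using Submodule.span_induction with
      | mem g hg =>
        obtain ⟨j, hj⟩ := hg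
        have h0 : (j : ℂ) + 1 ≠ 0 := by exact_mod_cast Nat.succ_ne_zero j
        refine Submodule.mem_iSup_of_mem _ (Submodule.mem_iSup_of_mem h0 ?_)
        rw [Module.End.mem_eigenspace_iff, hE, LinearMap.rTensor_tmul, hj,
          TensorProduct.smul_tmul']
      | zero => simp
      | add x y _ _ hx hy => rw [TensorProduct.add_tmul]; exact add_mem hx hy
      | smul c x _ hx => rw [← TensorProduct.smul_tmul']; exact Submodule.smul_mem _ _ hx
  obtain ⟨v, hv⟩ := key x
  refine ⟨v, sub_eq_zero.1 ?_⟩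
  refine Submodule.disjoint_def.1 (Module.End.eigenspaces_iSupIndep E 0) _ ?_ hv
  rw [Module.End.mem_eigenspace_iff, map_sub, hE0, hE, LinearMap.rTensor_tmul]
  simp [euler_apply]

end tensorKernel

/-! ### Graded subspaces -/

section graded

variable {M : Type*} [AddCommGroup M] [Module ℂ M] [SuperSpace M]

theorem part_disjoint (p : ZMod 2) :
    Disjoint (SuperSpace.part (V := M) p) (SuperSpace.part (p + 1)) := by
  rcases zmod_cases p with rfl | rfl
  · simpa using (SuperSpace.isCompl (V := M)).disjoint
  · simpa [one_add_one'] using (SuperSpace.isCompl (V := M)).disjoint.symm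

theorem eq_zero_of_add_eq_zero {p : ZMod 2} {x y : M} (hx : x ∈ SuperSpace.part (V := M) p)
    (hy : y ∈ SuperSpace.part (V := M) (p + 1)) (h : x + y = 0) : x = 0 := by
  refine Submodule.disjoint_def.1 (part_disjoint p) x hx ?_
  rw [eq_neg_of_add_eq_zero_left h]
  exact neg_mem hy

/-- The odd component is the difference of the vector and its even component, so it needs no
separate check. -/
theorem isGraded_of_even_mem {N : Submodule ℂ M}
    (h : ∀ x ∈ SuperSpace.part (V := M) 0, ∀ y ∈ SuperSpace.part (V := M) 1, x + y ∈ N → x ∈ N) :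
    IsGraded N := by
  refine le_antisymm (fun v hv => ?_) (sup_le inf_le_left inf_le_left)
  have hv' : v ∈ SuperSpace.part (V := M) 0 ⊔ SuperSpace.part 1 := by
    rw [SuperSpace.isCompl.sup_eq_top]; trivial
  obtain ⟨x, hx, y, hy, rfl⟩ := Submodule.mem_sup.mp hv'
  have h1 := h x hx y hy hv
  exact Submodule.add_mem_sup ⟨h1, hx⟩ ⟨(Submodule.add_mem_iff_right N h1).1 hv, hy⟩

theorem IsGraded.le_of_hom {N P : Submodule ℂ M} (hN : IsGraded N)
    (h : ∀ p, ∀ v ∈ N, v ∈ SuperSpace.part (V := M) p → v ∈ P) : N ≤ P := by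
  rw [hN]
  exact sup_le (fun v hv => h 0 v hv.1 hv.2) (fun v hv => h 1 v hv.1 hv.2)

/-- An operator all of whose homogeneous pieces respect the grading maps homogeneous vectors to
homogeneous vectors. -/
theorem mem_part_of_sup_eq_top {π : M →ₗ[ℂ] M}
    (h : ∀ v, v ∈ (SuperSpace.part 0 ⊓ (SuperSpace.part (V := M) 0).comap π) ⊔
      (SuperSpace.part 1 ⊓ (SuperSpace.part (V := M) 1).comap π))
    {p : ZMod 2} {v : M} (hv : v ∈ SuperSpace.part (V := M) p) : π v ∈ SuperSpace.part (V := M) p := by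
  obtain ⟨x, hx, y, hy, rfl⟩ := Submodule.mem_sup.mp (h v)
  rcases zmod_cases p with rfl | rfl
  · have : y = 0 := Submodule.disjoint_def.1 SuperSpace.isCompl.disjoint y
      ((Submodule.add_mem_iff_right _ hx.1).1 hv) hy.1
    simpa [this] using hx.2
  · have : x = 0 := Submodule.disjoint_def.1 SuperSpace.isCompl.disjoint x hx.1
      ((Submodule.add_mem_iff_left _ hy.1).1 hv)
    simpa [this] using hy.2

/-- An injective linear map that respects the gradings reflects them. -/
theorem mem_part_iff_of_injective {N : Type*} [AddCommGroup N] [Module ℂ N] [SuperSpace N]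
    {φ : N →ₗ[ℂ] M} (hφ : Function.Injective φ)
    (h : ∀ p, ∀ x ∈ SuperSpace.part (V := N) p, φ x ∈ SuperSpace.part (V := M) p) (p : ZMod 2)
    (x : N) : x ∈ SuperSpace.part (V := N) p ↔ φ x ∈ SuperSpace.part (V := M) p := by
  refine ⟨h p x, fun hx => ?_⟩
  have hv' : x ∈ SuperSpace.part (V := N) 0 ⊔ SuperSpace.part 1 := by
    rw [SuperSpace.isCompl.sup_eq_top]; trivial
  obtain ⟨y, hy, z, hz, rfl⟩ := Submodule.mem_sup.mp hv'
  rw [map_add] at hx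
  rcases zmod_cases p with rfl | rfl
  · have : φ z = 0 := Submodule.disjoint_def.1 SuperSpace.isCompl.disjoint _
      ((Submodule.add_mem_iff_right _ (h 0 y hy)).1 hx) (h 1 z hz)
    rw [(map_eq_zero_iff φ hφ).1 this, add_zero]
    exact hy
  · have : φ y = 0 := Submodule.disjoint_def.1 SuperSpace.isCompl.disjoint _ (h 0 y hy)
      ((Submodule.add_mem_iff_left _ (h 1 z hz)).1 hx)
    rw [(map_eq_zero_iff φ hφ).1 this, zero_add]
    exact hz

end graded

/-! ### The twisted derivatives on an `AW`-module -/

/-- The values `φ_a(∂_s)`. -/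
def chi (a : Fin m → ℂ) : Fin m ⊕ Fin n → ℂ := Sum.elim a fun _ => 0

/-- The character vanishes on odd derivatives, and signs attached to even ones are trivial. For this
reason the shift by `φ_a` disturbs neither the Leibniz rule nor the super commutators. -/
theorem chi_mul_sgn (a : Fin m → ℂ) (s : Fin m ⊕ Fin n) (p : ZMod 2) :
    chi a s * sgn (par s) p = chi a s := by
  rcases s with i | j <;> simp [chi, par]

theorem chi_smul_gam (a : Fin m → ℂ) (s : Fin m ⊕ Fin n) (f : A m n) :
    chi a s • gam (par s) f = chi a s • f := by
  rcases s with i | j <;> simp [chi, par]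

theorem delta_eq (c : Fin m ⊕ Fin n → ℂ) : delta c = ∑ s, c s • field s (1 : A m n) := by
  refine Subtype.ext ?_
  rw [AddSubmonoidClass.coe_finsetSum]
  simp [delta, fieldEnd_one]

theorem phi_eq (a : Fin m → ℂ) (c : Fin m ⊕ Fin n → ℂ) : phi a c = ∑ s, c s * chi a s := by
  simp [phi, chi, Fintype.sum_sum_type]

theorem delta_single (s : Fin m ⊕ Fin n) : delta (Pi.single s 1) = field s (1 : A m n) := by
  simp [delta_eq, Pi.single_apply]

theorem phi_single (a : Fin m → ℂ) (s : Fin m ⊕ Fin n) : phi a (Pi.single s 1) = chi a s := by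
  simp [phi_eq, Pi.single_apply]

namespace AWModule

variable {M : Type*} [AddCommGroup M] [Module ℂ M] [SuperSpace M]
variable (𝓜 : AWModule m n M) (a : Fin m → ℂ)

theorem actA_mul (f g : A m n) (v : M) : 𝓜.actA (f * g) v = 𝓜.actA f (𝓜.actA g v) := by
  rw [map_mul, Module.End.mul_apply]

theorem actW_actA_apply {p : ZMod 2} {D : Module.End ℂ (A m n)} (hD : D ∈ WPart m n p)
    (f : A m n) (v : M) : 𝓜.actW ⟨D, WPart_le p hD⟩ (𝓜.actA f v) =
      𝓜.actA (D f) v + 𝓜.actA (gam p f) (𝓜.actW ⟨D, WPart_le p hD⟩ v) := by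
  induction f using A_hom_induction with
  | hadd x y hx hy => simp only [map_add, LinearMap.add_apply, hx, hy]; abel
  | hp q x hx =>
    have h := congrArg (fun φ : Module.End ℂ M => φ v) (𝓜.actW_actA hD hx)
    simp only [sbr, LinearMap.sub_apply, LinearMap.smul_apply, Module.End.mul_apply] at h
    rw [gam_of_mem hx, map_smul, LinearMap.smul_apply]
    exact sub_eq_iff_eq_add.1 h

theorem actW_comm {p q : ZMod 2} {D E : Module.End ℂ (A m n)} (hD : D ∈ WPart m n p)
    (hE : E ∈ WPart m n q) (v : M) :
    𝓜.actW ⟨D, WPart_le p hD⟩ (𝓜.actW ⟨E, WPart_le q hE⟩ v) =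
      𝓜.actW ⟨sbr p q D E, WPart_le (p + q) (sbr_mem_WPart hD hE)⟩ v +
        sgn p q • 𝓜.actW ⟨E, WPart_le q hE⟩ (𝓜.actW ⟨D, WPart_le p hD⟩ v) := by
  rw [𝓜.actW_sbr hD hE]
  simp [sbr]

/-- The action of `∂_s - φ_a(∂_s)`. -/
def twistedPd (s : Fin m ⊕ Fin n) : Module.End ℂ M :=
  𝓜.actW (field s 1) - chi a s • (1 : Module.End ℂ M)

theorem twistedPd_apply (s : Fin m ⊕ Fin n) (v : M) :
    𝓜.twistedPd a s v = 𝓜.actW (field s 1) v - chi a s • v := rfl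

theorem field_one_eq (s : Fin m ⊕ Fin n) :
    field s (1 : A m n) = ⟨pd s, WPart_le _ (pd_mem_WPart s)⟩ := Subtype.ext (fieldEnd_one s)

theorem mem_Wh_iff {v : M} : v ∈ 𝓜.Wh a ↔ ∀ s, 𝓜.twistedPd a s v = 0 := by
  constructor
  · intro h s
    have := h (Pi.single s 1)
    rw [delta_single, phi_single] at this
    rw [twistedPd_apply, this, sub_self]
  · intro h c
    rw [delta_eq, phi_eq, map_sum, LinearMap.sum_apply, Finset.sum_smul]
    refine Finset.sum_congr rfl fun s _ => ?_
    have h1 : 𝓜.actW (field s 1) v = chi a s • v := sub_eq_zero.1 (h s)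
    rw [map_smul, LinearMap.smul_apply, h1, smul_smul]

theorem actW_field_one {v : M} (hv : v ∈ 𝓜.Wh a) (s : Fin m ⊕ Fin n) :
    𝓜.actW (field s 1) v = chi a s • v := sub_eq_zero.1 ((𝓜.mem_Wh_iff a).1 hv s)

theorem twistedPd_actA (s : Fin m ⊕ Fin n) (f : A m n) (v : M) :
    𝓜.twistedPd a s (𝓜.actA f v) =
      𝓜.actA (pd s f) v + 𝓜.actA (gam (par s) f) (𝓜.twistedPd a s v) := by
  simp only [twistedPd_apply]
  rw [field_one_eq, 𝓜.actW_actA_apply (pd_mem_WPart s), map_sub, map_smul, ← LinearMap.smul_apply, ← map_smul,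
    ← chi_smul_gam, map_smul, LinearMap.smul_apply]
  abel

theorem twistedPd_actW (s : Fin m ⊕ Fin n) {p : ZMod 2} {D : Module.End ℂ (A m n)}
    (hD : D ∈ WPart m n p) (v : M) : 𝓜.twistedPd a s (𝓜.actW ⟨D, WPart_le p hD⟩ v) =
      𝓜.actW ⟨sbr (par s) p (pd s) D, WPart_le _ (sbr_mem_WPart (pd_mem_WPart s) hD)⟩ v +
        sgn (par s) p • 𝓜.actW ⟨D, WPart_le p hD⟩ (𝓜.twistedPd a s v) := by
  simp only [twistedPd_apply]
  rw [field_one_eq, 𝓜.actW_comm (pd_mem_WPart s) hD, map_sub, map_smul, smul_sub, smul_smul,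
    mul_comm, chi_mul_sgn, add_sub_assoc]

theorem twistedPd_comm (s t : Fin m ⊕ Fin n) (v : M) :
    𝓜.twistedPd a s (𝓜.twistedPd a t v) =
      sgn (par s) (par t) • 𝓜.twistedPd a t (𝓜.twistedPd a s v) := by
  have h0 : sbr (par s) (par t) (pd s : Module.End ℂ (A m n)) (pd t) = 0 := by
    ext f
    simp [sbr, pd_pd s t]
  have h1 := 𝓜.twistedPd_actW a s (pd_mem_WPart t) v
  have h2 : (⟨sbr (par s) (par t) (pd s : Module.End ℂ (A m n)) (pd t),
      WPart_le _ (sbr_mem_WPart (pd_mem_WPart s) (pd_mem_WPart t))⟩ : W m n) = 0 :=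
    Subtype.ext h0
  rw [h2, map_zero, LinearMap.zero_apply, zero_add, ← field_one_eq] at h1
  rw [𝓜.twistedPd_apply a t v, map_sub, map_smul, h1,
    𝓜.twistedPd_apply a t (𝓜.twistedPd a s v), smul_sub, smul_smul, sgn_comm, mul_comm,
    chi_mul_sgn]

theorem twistedPd_mem {p : ZMod 2} {v : M} (hv : v ∈ SuperSpace.part (V := M) p)
    (s : Fin m ⊕ Fin n) : 𝓜.twistedPd a s v ∈ SuperSpace.part (V := M) (par s + p) := by
  rw [twistedPd_apply]
  refine sub_mem ?_ ?_
  · rw [field_one_eq]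
    exact 𝓜.actW_mem (pd_mem_WPart s) hv
  · rcases s with i | j
    · simpa [par] using Submodule.smul_mem _ _ hv
    · simp [chi]

/-- The operator `∑ x_s (∂_s - φ_a(∂_s))`. -/
def twistedEuler : Module.End ℂ M := ∑ s, 𝓜.actA (X s) * 𝓜.twistedPd a s

theorem twistedEuler_apply (v : M) :
    𝓜.twistedEuler a v = ∑ s, 𝓜.actA (X s) (𝓜.twistedPd a s v) := by
  simp [twistedEuler, LinearMap.sum_apply]

theorem twistedPd_twistedEuler (t : Fin m ⊕ Fin n) (v : M) :
    𝓜.twistedPd a t (𝓜.twistedEuler a v) =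
      𝓜.twistedPd a t v + 𝓜.twistedEuler a (𝓜.twistedPd a t v) := by
  have h : ∀ s, 𝓜.twistedPd a t (𝓜.actA (X s) (𝓜.twistedPd a s v)) =
      (if t = s then 𝓜.twistedPd a s v else 0) +
        𝓜.actA (X s) (𝓜.twistedPd a s (𝓜.twistedPd a t v)) := by
    intro s
    rw [twistedPd_actA, pd_X, gam_X, twistedPd_comm 𝓜 a t s, map_smul, map_smul,
      LinearMap.smul_apply, smul_smul, sgn_mul_self, one_smul]
    congr 1
    split_ifs <;> simp
  simp only [twistedEuler_apply, map_sum, h, Finset.sum_add_distrib, Finset.sum_ite_eq,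
    Finset.mem_univ, if_true]

/-- The twisted Euler operator is the scalar `k` on the `k`-th layer of the filtration. Each twisted
derivative satisfies `[P_t, E] = P_t`, so it carries `E - (k + 1)` on one layer to `E - k` on the
layer below. -/
theorem twistedEuler_sub_mem_killed {k : ℕ} {v : M} (hv : v ∈ killed (𝓜.twistedPd a) (k + 1)) :
    𝓜.twistedEuler a v - (k : ℂ) • v ∈ killed (𝓜.twistedPd a) k := by
  induction k generalizing v with
  | zero =>
    have h : ∀ s, 𝓜.twistedPd a s v = 0 := fun s => by
      simpa [killed] using mem_killed_succ.1 hv s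
    simp [twistedEuler_apply, h]
  | succ k ih =>
    refine mem_killed_succ.2 fun s => ?_
    have h := ih (mem_killed_succ.1 hv s)
    rw [map_sub, map_smul, twistedPd_twistedEuler]
    convert h using 1
    push_cast
    module

theorem exists_mem_killed_twistedPd (ha : 𝓜.IsOfType a) (v : M) :
    ∃ k, v ∈ killed (𝓜.twistedPd a) k := by
  obtain ⟨k, hk⟩ := ha v
  refine exists_mem_killed (r := fun _ => k) (fun s t => ⟨_, 𝓜.twistedPd_comm a s t⟩) fun s => ?_
  have := hk (Pi.single s 1)
  rwa [delta_single, phi_single] at this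

/-! ### Subspaces generated under `A` -/

/-- The `A`-submodule generated by a subspace. -/
def gen (N : Submodule ℂ M) : Submodule ℂ M := Submodule.map₂ 𝓜.actA.toLinearMap ⊤ N

variable {𝓜} in
theorem actA_mem_gen {N : Submodule ℂ M} (f : A m n) {v : M} (hv : v ∈ N) :
    𝓜.actA f v ∈ 𝓜.gen N :=
  Submodule.apply_mem_map₂ 𝓜.actA.toLinearMap (Submodule.mem_top (x := f)) hv

variable {𝓜} in
theorem gen_le {N P : Submodule ℂ M} (h : ∀ f, ∀ v ∈ N, 𝓜.actA f v ∈ P) : 𝓜.gen N ≤ P :=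
  Submodule.map₂_le.2 fun f _ v hv => h f v hv

theorem le_gen (N : Submodule ℂ M) : N ≤ 𝓜.gen N := fun v hv => by
  simpa using actA_mem_gen (𝓜 := 𝓜) 1 hv

variable {𝓜} in
theorem gen_actA {N : Submodule ℂ M} (f : A m n) {v : M} (hv : v ∈ 𝓜.gen N) :
    𝓜.actA f v ∈ 𝓜.gen N := by
  refine (gen_le (P := (𝓜.gen N).comap (𝓜.actA f)) fun g w hw => ?_) hv
  rw [Submodule.mem_comap, ← actA_mul]
  exact actA_mem_gen _ hw

variable {𝓜} in
-- Moving `D` past a function produces only another function, so stability has to be tested on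
-- generators alone.
theorem gen_actW {N : Submodule ℂ M} (h : ∀ D, ∀ v ∈ N, 𝓜.actW D v ∈ 𝓜.gen N) (D : W m n)
    {v : M} (hv : v ∈ 𝓜.gen N) : 𝓜.actW D v ∈ 𝓜.gen N := by
  induction D using W_induction with
  | hadd x y hx hy => rw [map_add]; exact add_mem hx hy
  | hp p D hD =>
    refine (gen_le (P := (𝓜.gen N).comap (𝓜.actW ⟨D, WPart_le p hD⟩)) fun g w hw => ?_) hv
    rw [Submodule.mem_comap, 𝓜.actW_actA_apply hD]
    exact add_mem (actA_mem_gen _ hw) (gen_actA _ (h _ _ hw))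

theorem gen_isGraded {N : Submodule ℂ M} (hN : IsGraded N) : IsGraded (𝓜.gen N) := by
  refine le_antisymm (gen_le fun f v hv => ?_) (sup_le inf_le_left inf_le_left)
  induction f using A_hom_induction with
  | hadd x y hx hy => rw [map_add]; exact add_mem hx hy
  | hp p f hf =>
    refine hN.le_of_hom (P := Submodule.comap (𝓜.actA f)
      (𝓜.gen N ⊓ SuperSpace.part 0 ⊔ 𝓜.gen N ⊓ SuperSpace.part 1)) (fun q w hw hq => ?_) hv
    have h1 := 𝓜.actA_mem hf hq
    have h2 := actA_mem_gen (𝓜 := 𝓜) f hw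
    rw [Submodule.mem_comap]
    rcases zmod_cases (p + q) with h | h <;> rw [h] at h1
    · exact Submodule.mem_sup_left ⟨h2, h1⟩
    · exact Submodule.mem_sup_right ⟨h2, h1⟩

variable {𝓜} in
-- The form in which irreducibility is used, for the singular vectors and for `gl(m,n)`-submodules
-- of the Whittaker vectors.
theorem IsSimple.gen_eq_top (h𝓜 : 𝓜.IsSimple) {N : Submodule ℂ M} (hN : IsGraded N)
    (h : ∀ D, ∀ v ∈ N, 𝓜.actW D v ∈ 𝓜.gen N) (h0 : N ≠ ⊥) : 𝓜.gen N = ⊤ := by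
  refine (h𝓜.2 _ (𝓜.gen_isGraded hN) (fun f v hv => gen_actA f hv)
    (fun D v hv => gen_actW h D hv)).resolve_left fun h1 => h0 ?_
  rw [← le_bot_iff, ← h1]
  exact 𝓜.le_gen N

/-! ### Freeness of `M` over `A` on the Whittaker vectors -/

/-- For `v` in layer `k ≥ 1`, write `k v = E v - (E v - k v)` with `E` the twisted Euler operator:
`E v` is an `A`-combination of derivatives of `v`, and these as well as `E v - k v` lie one step
lower. The bottom layer consists of the Whittaker vectors themselves. -/
theorem mem_gen_Wh {k : ℕ} {v : M} (hv : v ∈ killed (𝓜.twistedPd a) k) :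
    v ∈ 𝓜.gen (𝓜.Wh a) := by
  induction k generalizing v with
  | zero =>
    have : v = 0 := by simpa [killed] using hv
    rw [this]
    exact zero_mem _
  | succ k ih =>
    rcases Nat.eq_zero_or_pos k with rfl | hk
    · refine 𝓜.le_gen _ ((𝓜.mem_Wh_iff a).2 fun s => ?_)
      simpa [killed] using mem_killed_succ.1 hv s
    · have h1 : 𝓜.twistedEuler a v ∈ 𝓜.gen (𝓜.Wh a) := by
        rw [twistedEuler_apply]
        exact sum_mem fun s _ => gen_actA _ (ih (mem_killed_succ.1 hv s))
      have h2 := sub_mem h1 (ih (𝓜.twistedEuler_sub_mem_killed a hv))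
      rw [sub_sub_cancel] at h2
      exact ((𝓜.gen (𝓜.Wh a)).smul_mem_iff (by exact_mod_cast hk.ne')).1 h2

theorem gen_Wh (ha : 𝓜.IsOfType a) : 𝓜.gen (𝓜.Wh a) = ⊤ := by
  rw [eq_top_iff]
  intro v _
  obtain ⟨k, hk⟩ := 𝓜.exists_mem_killed_twistedPd a ha v
  exact 𝓜.mem_gen_Wh a hk

theorem Wh_isGraded : IsGraded (𝓜.Wh a) := by
  refine isGraded_of_even_mem fun x hx y hy h => (𝓜.mem_Wh_iff a).2 fun s => ?_
  refine eq_zero_of_add_eq_zero (𝓜.twistedPd_mem a hx s) (y := 𝓜.twistedPd a s y) ?_ ?_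
  · simpa [add_assoc] using 𝓜.twistedPd_mem a hy s
  · rw [← map_add]
    exact (𝓜.mem_Wh_iff a).1 h s

instance : SuperSpace (𝓜.Wh a) where
  part p := (SuperSpace.part (V := M) p).comap (𝓜.Wh a).subtype
  isCompl := by
    constructor
    · rw [Submodule.disjoint_def]
      intro x h0 h1
      exact Subtype.ext (Submodule.disjoint_def.1 SuperSpace.isCompl.disjoint _ h0 h1)
    · rw [codisjoint_iff, eq_top_iff]
      rintro ⟨x, hx⟩ _
      have hx' := hx
      rw [𝓜.Wh_isGraded a] at hx'
      obtain ⟨y, hy, z, hz, h⟩ := Submodule.mem_sup.mp hx'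
      have : (⟨x, hx⟩ : 𝓜.Wh a) = ⟨y, hy.1⟩ + ⟨z, hz.1⟩ := Subtype.ext h.symm
      rw [this]
      exact Submodule.add_mem_sup hy.2 hz.2

/-- The multiplication map `A ⊗ Wh_a(M) → M`. -/
def mulMap : A m n ⊗[ℂ] 𝓜.Wh a →ₗ[ℂ] M :=
  TensorProduct.lift (𝓜.actA.toLinearMap.compl₂ (𝓜.Wh a).subtype)

@[simp] theorem mulMap_tmul (f : A m n) (v : 𝓜.Wh a) :
    𝓜.mulMap a (f ⊗ₜ v) = 𝓜.actA f v := rfl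

theorem twistedPd_mulMap (s : Fin m ⊕ Fin n) (x : A m n ⊗[ℂ] 𝓜.Wh a) :
    𝓜.twistedPd a s (𝓜.mulMap a x) = 𝓜.mulMap a (pdTensor _ s x) := by
  induction x using TensorProduct.induction_on with
  | zero => simp
  | add x y hx hy => simp only [map_add, hx, hy]
  | tmul f v =>
    rw [mulMap_tmul, twistedPd_actA, (𝓜.mem_Wh_iff a).1 v.2 s, map_zero, add_zero]
    rfl

/-- The kernel is stable under the operators `∂_s ⊗ 1`. By induction on the number of derivatives
needed to kill it, a kernel element has vanishing derivatives, hence equals `1 ⊗ v`, whose image is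
`v`. -/
theorem mulMap_injective : Function.Injective (𝓜.mulMap a) := by
  refine (injective_iff_map_eq_zero _).2 fun x hx => ?_
  obtain ⟨k, hk⟩ := tensor_mem_killed x
  induction k generalizing x with
  | zero => simpa [killed] using hk
  | succ k ih =>
    obtain ⟨v, rfl⟩ := exists_eq_one_tmul fun s => ih (pdTensor _ s x)
      (by rw [← twistedPd_mulMap, hx, map_zero]) (mem_killed_succ.1 hk s)
    rw [mulMap_tmul, map_one, Module.End.one_apply] at hx
    rw [show v = 0 from Subtype.ext hx, TensorProduct.tmul_zero]

theorem mulMap_surjective (ha : 𝓜.IsOfType a) : Function.Surjective (𝓜.mulMap a) := by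
  rw [← LinearMap.range_eq_top, eq_top_iff, ← 𝓜.gen_Wh a ha]
  exact gen_le fun f v hv => ⟨f ⊗ₜ ⟨v, hv⟩, rfl⟩

theorem mulMap_mem {p : ZMod 2} {x : A m n ⊗[ℂ] 𝓜.Wh a} (hx : x ∈ SuperSpace.part p) :
    𝓜.mulMap a x ∈ SuperSpace.part (V := M) p := by
  refine tensorPart_induction (P := fun x => 𝓜.mulMap a x ∈ SuperSpace.part (V := M) p)
    (by simp) (fun x y hx hy => ?_) ?_ hx
  · rw [map_add]; exact add_mem hx hy
  · rintro q r f v hf hv rfl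
    exact 𝓜.actA_mem hf hv

theorem mulMap_smul (f : A m n) (x : A m n ⊗[ℂ] 𝓜.Wh a) :
    𝓜.mulMap a (f • x) = 𝓜.actA f (𝓜.mulMap a x) := by
  induction x using TensorProduct.induction_on with
  | zero => simp
  | add x y hx hy => simp only [smul_add, map_add, hx, hy]
  | tmul g v => rw [TensorProduct.smul_tmul', smul_eq_mul, mulMap_tmul, mulMap_tmul, actA_mul]

/-! ### The fibre of `M` at the origin -/

/-- A projection of `M` onto the Whittaker vectors along which `A` acts through the
augmentation. -/
structure IsFiberMap (π : M →ₗ[ℂ] M) : Prop where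
  mem : ∀ v, π v ∈ 𝓜.Wh a
  apply_of_mem : ∀ v ∈ 𝓜.Wh a, π v = v
  actA : ∀ f v, π (𝓜.actA f v) = eps f • π v

/-- Transport the evaluation `eps ⊗ 1` on `A ⊗ Wh_a(M)` along the multiplication isomorphism. -/
theorem exists_isFiberMap (ha : 𝓜.IsOfType a) : ∃ π : M →ₗ[ℂ] M, 𝓜.IsFiberMap a π := by
  let e := LinearEquiv.ofBijective (𝓜.mulMap a) ⟨𝓜.mulMap_injective a, 𝓜.mulMap_surjective a ha⟩
  let ev : A m n ⊗[ℂ] 𝓜.Wh a →ₗ[ℂ] 𝓜.Wh a :=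
    (TensorProduct.lid ℂ _).toLinearMap ∘ₗ (eps : A m n →ₐ[ℂ] ℂ).toLinearMap.rTensor _
  have hev : ∀ (f : A m n) x, ev (f • x) = eps f • ev x := by
    intro f x
    induction x using TensorProduct.induction_on with
    | zero => simp
    | add x y hx hy => simp only [smul_add, map_add, hx, hy]
    | tmul g v => simp [ev, TensorProduct.smul_tmul', smul_smul]
  have he : ∀ f v, e.symm (𝓜.actA f v) = f • e.symm v := by
    intro f v
    rw [LinearEquiv.symm_apply_eq]
    exact ((𝓜.mulMap_smul a f (e.symm v)).trans (congrArg _ (e.apply_symm_apply v))).symm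
  refine ⟨(𝓜.Wh a).subtype ∘ₗ ev ∘ₗ e.symm.toLinearMap, fun v => (ev (e.symm v)).2,
    fun v hv => ?_, fun f v => ?_⟩
  · have : e.symm v = 1 ⊗ₜ ⟨v, hv⟩ := by
      rw [LinearEquiv.symm_apply_eq]
      change v = 𝓜.mulMap a _
      simp
    simp [this, ev]
  · simp [he, hev]

end AWModule

/-- An operator on a nonzero finite-dimensional space has an eigenvalue `μ` such that no
`μ + j + 1` is an eigenvalue. -/
theorem exists_eigenvalue_top {V : Type*} [AddCommGroup V] [Module ℂ V] [FiniteDimensional ℂ V]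
    [Nontrivial V] (T : Module.End ℂ V) :
    ∃ μ : ℂ, T.HasEigenvalue μ ∧ ∀ j : ℕ, ¬ T.HasEigenvalue (μ + (j + 1)) := by
  obtain ⟨ν, hν⟩ := Module.End.exists_eigenvalue T
  -- Eigenvalues are complex, so maximality is taken on real parts; adding `j + 1` strictly
  -- increases the real part.
  obtain ⟨μ, hμ, hmax⟩ := Set.exists_max_image {μ | T.HasEigenvalue μ} Complex.re
    (Module.End.finite_hasEigenvalue T) ⟨ν, hν⟩
  refine ⟨μ, hμ, fun j hj => ?_⟩
  have h := hmax _ hj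
  simp only [Complex.add_re, Complex.natCast_re, Complex.one_re] at h
  have : (0 : ℝ) ≤ j := Nat.cast_nonneg j
  linarith

/-! ### Linear vector fields and `gl(m,n)` -/

theorem W_ext_of_X {D E : W m n}
    (h : ∀ s, (D : Module.End ℂ (A m n)) (X s) = (E : Module.End ℂ (A m n)) (X s)) : D = E := by
  rw [W_eq_sum_field D, W_eq_sum_field E]
  simp [h]

theorem eps_field_X (s : Fin m ⊕ Fin n) {f : A m n} (hf : eps f = 0) (l : Fin m ⊕ Fin n) :
    eps ((field s f : Module.End ℂ (A m n)) (X l)) = 0 := by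
  rw [coe_field, fieldEnd_apply, map_mul, hf, zero_mul]

variable (m n) in
/-- The Euler field `∑ x_s ∂_s` as an element of `W`. -/
def eulerField : W m n := ⟨euler, WPart_le 0 euler_mem_WPart⟩

/-- The linear vector field `x_i ↦ ∑ Y_{ki} x_k` attached to a matrix `Y`. -/
def matField : Matrix (Fin m ⊕ Fin n) (Fin m ⊕ Fin n) ℂ →ₗ[ℂ] W m n where
  toFun Y := ∑ i, ∑ k, Y k i • field i (X k)
  map_add' Y Z := by simp [add_smul, Finset.sum_add_distrib]
  map_smul' c Y := by simp [Finset.smul_sum, smul_smul]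

theorem matField_apply (Y : Matrix (Fin m ⊕ Fin n) (Fin m ⊕ Fin n) ℂ) :
    matField Y = ∑ i, ∑ k, Y k i • field i (X k) := rfl

theorem matField_X (Y : Matrix (Fin m ⊕ Fin n) (Fin m ⊕ Fin n) ℂ) (i : Fin m ⊕ Fin n) :
    (matField Y : Module.End ℂ (A m n)) (X i) = ∑ k, Y k i • X k := by
  simp only [matField_apply, AddSubmonoidClass.coe_finsetSum, Submodule.coe_smul, coe_field,
    LinearMap.sum_apply, LinearMap.smul_apply, fieldEnd_apply, pd_X, mul_ite, mul_one, mul_zero,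
    smul_ite, smul_zero]
  rw [Finset.sum_comm]
  simp

theorem eps_matField (Y : Matrix (Fin m ⊕ Fin n) (Fin m ⊕ Fin n) ℂ) (s : Fin m ⊕ Fin n) :
    eps ((matField Y : Module.End ℂ (A m n)) (X s)) = 0 := by
  simp [matField_X]

theorem matField_single (k i : Fin m ⊕ Fin n) :
    matField (Matrix.single k i (1 : ℂ)) = field i (X k) := by
  refine W_ext_of_X fun s => ?_
  rw [matField_X]
  by_cases h : i = s <;> simp [Matrix.single_apply, h]

theorem matField_mem_WPart {p : ZMod 2} {Y : Matrix (Fin m ⊕ Fin n) (Fin m ⊕ Fin n) ℂ}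
    (hY : Y ∈ glPart m n p) : (matField Y : Module.End ℂ (A m n)) ∈ WPart m n p := by
  simp only [matField_apply, AddSubmonoidClass.coe_finsetSum, Submodule.coe_smul, coe_field]
  refine sum_mem fun i _ => sum_mem fun k _ => ?_
  by_cases h : par k + par i = p
  · rw [← h]
    exact Submodule.smul_mem _ _ (fieldEnd_X_mem_WPart i k)
  · rw [hY k i h, zero_smul]
    exact zero_mem _

/-- On the span of the generators, linear fields compose as matrices multiply, and a superderivation
is determined by its values there. -/
theorem matField_sbr {p q : ZMod 2} {Y Z : Matrix (Fin m ⊕ Fin n) (Fin m ⊕ Fin n) ℂ}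
    (hY : Y ∈ glPart m n p) (hZ : Z ∈ glPart m n q) :
    matField (sbr p q Y Z) = ⟨sbr p q (matField Y : Module.End ℂ (A m n)) (matField Z),
      WPart_le _ (sbr_mem_WPart (matField_mem_WPart hY) (matField_mem_WPart hZ))⟩ := by
  have h : ∀ (Y Z : Matrix (Fin m ⊕ Fin n) (Fin m ⊕ Fin n) ℂ) (i : Fin m ⊕ Fin n),
      (matField (Y * Z) : Module.End ℂ (A m n)) (X i) =
        (matField Y : Module.End ℂ (A m n)) ((matField Z : Module.End ℂ (A m n)) (X i)) := by
    intro Y Z i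
    simp only [matField_X, map_sum, map_smul, Finset.smul_sum, smul_smul, Matrix.mul_apply,
      Finset.sum_smul]
    rw [Finset.sum_comm]
    simp only [mul_comm]
  refine W_ext_of_X fun s => ?_
  simp [sbr, h]

/-! ### The action of vector fields on the fibre -/

namespace AWModule

variable {M : Type*} [AddCommGroup M] [Module ℂ M] [SuperSpace M]
variable {𝓜 : AWModule m n M} {a : Fin m → ℂ} {π : M →ₗ[ℂ] M}

theorem actW_field_mem (s : Fin m ⊕ Fin n) {p q : ZMod 2} {f : A m n} {v : M}
    (hf : f ∈ APart m n p) (hv : v ∈ SuperSpace.part (V := M) q) :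
    𝓜.actW (field s f) v ∈ SuperSpace.part (V := M) (p + par s + q) :=
  𝓜.actW_mem (fieldEnd_mem_WPart s hf) hv

/-- The Euler field is even, so its super commutators are ordinary ones and `D` need not be
homogeneous. -/
theorem actW_euler_comm (D : W m n) : ∃ D' : W m n,
    (D' : Module.End ℂ (A m n)) = euler * (D : Module.End ℂ (A m n)) -
      (D : Module.End ℂ (A m n)) * euler ∧
    ∀ v, 𝓜.actW (eulerField m n) (𝓜.actW D v) =
      𝓜.actW D' v + 𝓜.actW D (𝓜.actW (eulerField m n) v) := by
  induction D using W_induction with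
  | hadd x y hx hy =>
    obtain ⟨x', hx, hx'⟩ := hx
    obtain ⟨y', hy, hy'⟩ := hy
    refine ⟨x' + y', ?_, fun v => ?_⟩
    · rw [Submodule.coe_add, Submodule.coe_add, hx, hy, mul_add, add_mul]
      abel
    · simp only [map_add, LinearMap.add_apply, hx', hy']
      abel
  | hp p D hD =>
    refine ⟨⟨sbr 0 p euler D, WPart_le _ (sbr_mem_WPart euler_mem_WPart hD)⟩, by simp [sbr],
      fun v => ?_⟩
    have := 𝓜.actW_comm euler_mem_WPart hD v
    rwa [sgn_zero_left, one_smul] at this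

namespace IsFiberMap

variable (hπ : 𝓜.IsFiberMap a π)
include hπ

theorem actW_field_actA (s : Fin m ⊕ Fin n) (f g : A m n) (v : M) :
    π (𝓜.actW (field s f) (𝓜.actA g v)) =
      (eps f * eps (pd s g)) • π v + eps g • π (𝓜.actW (field s f) v) := by
  induction f using A_hom_induction with
  | hadd x y hx hy =>
    simp only [map_add, LinearMap.add_apply, hx, hy]
    module
  | hp p f hf =>
    have h := 𝓜.actW_actA_apply (fieldEnd_mem_WPart s hf) g v
    rw [fieldEnd_apply] at h
    have h2 := congrArg π h
    rw [map_add, hπ.actA, hπ.actA, eps_gam, map_mul] at h2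
    exact h2

/-- A field vanishing at the origin preserves `𝔪M`, and `v - π v` lies in `𝔪M`. The field thus acts
on the fibre, and inner occurrences of `π` may be dropped. -/
theorem actW_apply (ha : 𝓜.IsOfType a) {D : W m n}
    (hD : ∀ s, eps ((D : Module.End ℂ (A m n)) (X s)) = 0) (v : M) :
    π (𝓜.actW D (π v)) = π (𝓜.actW D v) := by
  have h : ∀ s, ∀ f : A m n, eps f = 0 →
      π (𝓜.actW (field s f) (π v)) = π (𝓜.actW (field s f) v) := by
    intro s f hf
    have hv : v ∈ 𝓜.gen (𝓜.Wh a) := by rw [𝓜.gen_Wh a ha]; trivial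
    refine LinearMap.mem_eqLocus.1 (gen_le (P := LinearMap.eqLocus
      (π ∘ₗ 𝓜.actW (field s f) ∘ₗ π) (π ∘ₗ 𝓜.actW (field s f))) (fun g w hw => ?_) hv)
    rw [LinearMap.mem_eqLocus]
    simp only [LinearMap.comp_apply]
    rw [hπ.actW_field_actA, hf, hπ.actA, hπ.apply_of_mem w hw]
    simp
  rw [W_eq_sum_field D]
  simp only [map_sum, LinearMap.sum_apply]
  exact Finset.sum_congr rfl fun s _ => h s _ (hD s)

/-- On `f w` with `w` a Whittaker vector, `π` gives `eps f • w`, and `eps` kills odd functions. -/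
theorem mem_part {p : ZMod 2} (ha : 𝓜.IsOfType a) {v : M} (hv : v ∈ SuperSpace.part (V := M) p) :
    π v ∈ SuperSpace.part (V := M) p := by
  refine mem_part_of_sup_eq_top (fun v => ?_) hv
  have hv : v ∈ 𝓜.gen (𝓜.Wh a) := by rw [𝓜.gen_Wh a ha]; trivial
  refine gen_le (fun f w hw => ?_) hv
  induction f using A_hom_induction with
  | hadd x y hx hy => rw [map_add]; exact add_mem hx hy
  | hp p f hf =>
    refine (𝓜.Wh_isGraded a).le_of_hom (P := Submodule.comap (𝓜.actA f)
      ((SuperSpace.part 0 ⊓ (SuperSpace.part (V := M) 0).comap π) ⊔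
      (SuperSpace.part 1 ⊓ (SuperSpace.part (V := M) 1).comap π))) (fun q w hw hq => ?_) hw
    have h1 := 𝓜.actA_mem hf hq
    have h2 : π (𝓜.actA f w) ∈ SuperSpace.part (V := M) (p + q) := by
      rw [hπ.actA, hπ.apply_of_mem w hw]
      rcases zmod_cases p with rfl | rfl
      · rw [zero_add]
        exact Submodule.smul_mem _ _ hq
      · rw [eps_odd hf, zero_smul]
        exact zero_mem _
    rw [Submodule.mem_comap]
    rcases zmod_cases (p + q) with h | h <;> rw [h] at h1 h2
    · exact Submodule.mem_sup_left ⟨h1, h2⟩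
    · exact Submodule.mem_sup_right ⟨h1, h2⟩

/-- A space of Whittaker vectors can be recovered from the `A`-submodule it generates. -/
theorem mem_of_mem_gen {N : Submodule ℂ M} (hN : N ≤ 𝓜.Wh a) {v : M} (hv : v ∈ 𝓜.gen N) :
    π v ∈ N := by
  refine (gen_le (P := N.comap π) fun f w hw => ?_) hv
  rw [Submodule.mem_comap, hπ.actA, hπ.apply_of_mem w (hN hw)]
  exact N.smul_mem _ hw

end IsFiberMap

/-! ### Singular vectors -/

variable (𝓜 a π) in
/-- The Whittaker vectors on which the vector fields vanishing to second order at the origin act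
trivially modulo the augmentation ideal. -/
def singular : Submodule ℂ M :=
  𝓜.Wh a ⊓ ⨅ s, ⨅ t, ⨅ u, ⨅ g : A m n, LinearMap.ker (π ∘ₗ 𝓜.actW (field s (X t * (X u * g))))

theorem mem_singular {v : M} : v ∈ 𝓜.singular a π ↔ v ∈ 𝓜.Wh a ∧
    ∀ s t u, ∀ g : A m n, π (𝓜.actW (field s (X t * (X u * g))) v) = 0 := by
  simp [singular]

theorem mem_singular_of_hom {v : M} (hv : v ∈ 𝓜.Wh a) (h : ∀ s t u p, ∀ g ∈ APart m n p,
    π (𝓜.actW (field s (X t * (X u * g))) v) = 0) : v ∈ 𝓜.singular a π := by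
  refine mem_singular.2 ⟨hv, fun s t u g => ?_⟩
  induction g using A_hom_induction with
  | hadd x y hx hy => simp only [mul_add, map_add, LinearMap.add_apply, hx, hy, add_zero]
  | hp p g hg => exact h s t u p g hg

theorem singular_le_Wh : 𝓜.singular a π ≤ 𝓜.Wh a := inf_le_left

namespace IsFiberMap

variable (hπ : 𝓜.IsFiberMap a π)
include hπ

theorem singular_isGraded (ha : 𝓜.IsOfType a) : IsGraded (𝓜.singular a π) := by
  refine isGraded_of_even_mem fun x hx y hy h => ?_
  obtain ⟨hW, h0⟩ := mem_singular.1 h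
  have hxW : x ∈ 𝓜.Wh a := by
    refine (𝓜.mem_Wh_iff a).2 fun s => ?_
    refine eq_zero_of_add_eq_zero (𝓜.twistedPd_mem a hx s) (y := 𝓜.twistedPd a s y) ?_ ?_
    · simpa [add_assoc] using 𝓜.twistedPd_mem a hy s
    · rw [← map_add]
      exact (𝓜.mem_Wh_iff a).1 hW s
  refine mem_singular_of_hom hxW fun s t u p g hg => ?_
  have hf := mul_mem_APart (X_mem t) (mul_mem_APart (X_mem u) hg)
  refine eq_zero_of_add_eq_zero (hπ.mem_part ha (actW_field_mem s hf hx))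
    (y := π (𝓜.actW (field s (X t * (X u * g))) y)) ?_ ?_
  · simpa [add_assoc] using hπ.mem_part ha (actW_field_mem s hf hy)
  · rw [← map_add, ← map_add]
    exact h0 s t u g

/-- A highest-weight argument for the Euler field on the finite-dimensional fibre. The eigenvector
found need not be homogeneous; gradedness is handled by `singular_isGraded`. -/
theorem singular_ne_bot [FiniteDimensional ℂ (𝓜.Wh a)] (ha : 𝓜.IsOfType a)
    (h0 : 𝓜.Wh a ≠ ⊥) : 𝓜.singular a π ≠ ⊥ := by
  have : Nontrivial (𝓜.Wh a) := Submodule.nontrivial_iff_ne_bot.2 h0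
  let T : Module.End ℂ (𝓜.Wh a) :=
    (π.codRestrict (𝓜.Wh a) hπ.mem) ∘ₗ 𝓜.actW (eulerField m n) ∘ₗ (𝓜.Wh a).subtype
  have hT : ∀ v, (T v : M) = π (𝓜.actW (eulerField m n) v) := fun v => rfl
  obtain ⟨μ, hμ, hmax⟩ := exists_eigenvalue_top T
  obtain ⟨v, hv, hv0⟩ := hμ.exists_hasEigenvector
  rw [Module.End.mem_eigenspace_iff] at hv
  have hv' : π (𝓜.actW (eulerField m n) v) = μ • (v : M) := by rw [← hT, hv]; rfl
  refine (Submodule.ne_bot_iff _).2 ⟨v, mem_singular.2 ⟨v.2, fun s t u g => ?_⟩,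
    fun h => hv0 (Subtype.ext h)⟩
  have hg : g ∈ Submodule.span ℂ {g : A m n | ∃ j : ℕ, euler g = (j : ℂ) • g} := by
    rw [span_homogeneous]; trivial
  induction hg using Submodule.span_induction with
  | mem g hg =>
    obtain ⟨j, hj⟩ := hg
    set D : W m n := field s (X t * (X u * g)) with hD
    have heps : ∀ l, eps ((D : Module.End ℂ (A m n)) (X l)) = 0 := fun l =>
      eps_field_X s (by simp) l
    have heps' : ∀ l, eps ((eulerField m n : Module.End ℂ (A m n)) (X l)) = 0 := by
      intro l; simp [eulerField]
    obtain ⟨D', hD', hcomm⟩ := actW_euler_comm (𝓜 := 𝓜) D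
    -- The coefficient has degree `j + 2` and `∂_s` has degree `-1`.
    have hDD' : D' = ((j : ℂ) + 1) • D := by
      refine Subtype.ext (hD'.trans (euler_comm_fieldEnd s ?_))
      rw [euler_mul, euler_mul, euler_X, euler_X, hj, mul_add, mul_smul_comm, mul_smul_comm]
      module
    by_contra hne
    -- If nonzero, `π (D v)` would be an eigenvector of `T` with eigenvalue `μ + (j + 1)`, against
    -- the choice of `μ`.
    refine hmax j (Module.End.hasEigenvalue_of_hasEigenvector
      (x := ⟨π (𝓜.actW D v), hπ.mem _⟩) ⟨?_, fun h => hne (congrArg Subtype.val h)⟩)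
    rw [Module.End.mem_eigenspace_iff]
    refine Subtype.ext ?_
    rw [hT]
    change π (𝓜.actW (eulerField m n) (π (𝓜.actW D v))) = _ • π (𝓜.actW D v)
    rw [hπ.actW_apply ha heps', hcomm, map_add, hDD', map_smul, LinearMap.smul_apply, map_smul,
      ← hπ.actW_apply ha heps (𝓜.actW (eulerField m n) v), hv', map_smul, map_smul]
    module
  | zero => simp
  | add x y _ _ hx hy => simp only [mul_add, map_add, LinearMap.add_apply, hx, hy, add_zero]
  | smul c x _ hx =>
    simp only [mul_smul_comm, map_smul, LinearMap.smul_apply, hx, smul_zero]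

/-- The action of vector fields on singular vectors. -/
theorem actW_field_singular {v : M} (hv : v ∈ 𝓜.singular a π) (s : Fin m ⊕ Fin n) (f : A m n) :
    𝓜.actW (field s f) v = chi a s • 𝓜.actA f v +
      ∑ k, 𝓜.actA (gam (par k) (pd k f)) (π (𝓜.actW (field s (X k)) v)) := by
  obtain ⟨hW, h2⟩ := mem_singular.1 hv
  -- Both sides agree on the fibre. For `f = 1` this is the Whittaker condition, for a generator it
  -- is immediate, and for a multiple of a product of two generators both sides vanish, the left one
  -- by singularity.
  have hfib : ∀ f : A m n, π (𝓜.actW (field s f) v) = π (chi a s • 𝓜.actA f v +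
      ∑ k, 𝓜.actA (gam (par k) (pd k f)) (π (𝓜.actW (field s (X k)) v))) := by
    intro f
    have hππ : ∀ w, π (π w) = π w := fun w => hπ.apply_of_mem _ (hπ.mem w)
    simp only [map_add, map_smul, map_sum, hπ.actA, eps_gam, hππ]
    induction f using A_induction_two with
    | h1 => simp [𝓜.actW_field_one a hW]
    | hX l => simp
    | hs c x hx =>
      simp only [map_smul, LinearMap.smul_apply, hx, smul_add, Finset.smul_sum, smul_smul,
        smul_eq_mul]
      congr 2
      ring
    | hadd x y hx hy =>
      simp only [map_add, LinearMap.add_apply, hx, hy, add_smul, smul_add,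
        Finset.sum_add_distrib]
      abel
    | hXX t u x =>
      have : ∀ k, eps (pd k (X t * (X u * x))) = 0 := by
        intro k
        rw [pd_X_mul, gam_X]
        split_ifs <;> simp
      simp [h2, this]
  have key : ∀ k p, ∀ f ∈ APart m n p, f ∈ killed (pd (m := m) (n := n)) k →
      𝓜.actW (field s f) v = chi a s • 𝓜.actA f v +
        ∑ k, 𝓜.actA (gam (par k) (pd k f)) (π (𝓜.actW (field s (X k)) v)) := by
    intro k
    induction k with
    | zero =>
      intro p f _ hf
      have : f = 0 := by simpa [killed] using hf
      simp [this]
    | succ k ih =>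
      intro p f hf hk
      have h0 : ∀ w ∈ 𝓜.Wh a, ∀ t, ∀ g, 𝓜.twistedPd a t (𝓜.actA g w) = 𝓜.actA (pd t g) w := by
        intro w hw t g
        rw [twistedPd_actA, (𝓜.mem_Wh_iff a).1 hw, map_zero, add_zero]
      -- Each twisted derivative of the difference is the same difference with `f` replaced by `∂_t
      -- f`, which is zero by induction. So the difference is a Whittaker vector, hence fixed by
      -- `π`, while `hfib` says that `π` kills it.
      have h1 : 𝓜.actW (field s f) v - (chi a s • 𝓜.actA f v +
          ∑ k, 𝓜.actA (gam (par k) (pd k f)) (π (𝓜.actW (field s (X k)) v))) ∈ 𝓜.Wh a := by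
        refine (𝓜.mem_Wh_iff a).2 fun t => ?_
        have h3 : 𝓜.twistedPd a t (𝓜.actW (field s f) v) = 𝓜.actW (field s (pd t f)) v := by
          have h4 := 𝓜.twistedPd_actW a t (fieldEnd_mem_WPart s hf) v
          simp only [sbr_pd_fieldEnd t s hf] at h4
          rw [(𝓜.mem_Wh_iff a).1 hW, map_zero, smul_zero, add_zero] at h4
          exact h4
        have h5 : ∀ k, pd t (gam (par k) (pd k f)) = gam (par k) (pd k (pd t f)) := by
          intro k
          rw [pd_pd k t, map_smul, gam_pd (par k) t, smul_smul, sgn_mul_self, one_smul]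
        rw [map_sub, h3, map_add, map_smul, map_sum, h0 v hW, sub_eq_zero]
        simp only [h0 _ (hπ.mem _), h5]
        exact ih _ _ (pd_mem t hf) (mem_killed_succ.1 hk t)
      rw [← sub_eq_zero, ← hπ.apply_of_mem _ h1, map_sub, hfib, sub_self]
  induction f using A_hom_induction with
  | hadd x y hx hy =>
    simp only [map_add, LinearMap.add_apply, hx, hy, smul_add, Finset.sum_add_distrib]
    abel
  | hp p f hf =>
    obtain ⟨k, hk⟩ := A_mem_killed f
    exact key k p f hf hk

/-- For `D` vanishing to second order and `E` linear, `D E = [D, E] ± E D` on the fibre. The last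
term kills singular vectors, and `[D, E]` again vanishes to second order. -/
theorem singular_stable (ha : 𝓜.IsOfType a) {v : M} (hv : v ∈ 𝓜.singular a π)
    (i k : Fin m ⊕ Fin n) : π (𝓜.actW (field i (X k)) v) ∈ 𝓜.singular a π := by
  obtain ⟨hW, h2⟩ := mem_singular.1 hv
  refine mem_singular_of_hom (hπ.mem _) fun s t u p g hg => ?_
  have hf := mul_mem_APart (X_mem t) (mul_mem_APart (X_mem u) hg)
  have hD := fieldEnd_mem_WPart s hf
  have hE := fieldEnd_X_mem_WPart i k
  rw [hπ.actW_apply ha (eps_field_X s (by simp))]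
  have h3 := congrArg π (𝓜.actW_comm hD hE v)
  have h4 : π (𝓜.actW (field i (X k)) (𝓜.actW (field s (X t * (X u * g))) v)) = 0 := by
    rw [← hπ.actW_apply ha (eps_field_X i (by simp)), h2, map_zero, map_zero]
  rw [map_add, map_smul] at h3
  change _ = _ + _ • π (𝓜.actW (field i (X k)) (𝓜.actW (field s (X t * (X u * g))) v)) at h3
  rw [h4, smul_zero, add_zero] at h3
  refine h3.trans ?_
  -- `N` collects the coefficients `f` for which every `f ∂_r` sends `v` to zero in the fibre. It
  -- contains all multiples of products of two generators, so it suffices to see that the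
  -- coefficients of the bracket are of this kind.
  let N : Submodule ℂ (A m n) := ⨅ r, LinearMap.ker (π ∘ₗ LinearMap.applyₗ v ∘ₗ 𝓜.actW ∘ₗ field r)
  have hN : ∀ f, f ∈ N ↔ ∀ r, π (𝓜.actW (field r f) v) = 0 := fun f => by simp [N]
  have hXX : ∀ t u g, X t * (X u * g) ∈ N := fun t u g => (hN _).2 fun r => h2 r t u g
  rw [W_eq_sum_field (Subtype.mk _ _), map_sum, LinearMap.sum_apply, map_sum]
  refine Finset.sum_eq_zero fun l _ => (hN _).1 (sub_mem ?_ (N.smul_mem _ ?_)) l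
  · rw [Module.End.mul_apply, fieldEnd_apply s, mul_assoc, mul_assoc]
    exact hXX _ _ _
  · rw [Module.End.mul_apply, fieldEnd_apply s, fieldEnd_apply i, mul_assoc, mul_assoc, pd_X_mul,
      pd_X_mul, gam_X, gam_X, mul_add, mul_add, mul_add, smul_mul_assoc, smul_mul_assoc,
      mul_smul_comm, mul_smul_comm, smul_mul_assoc, mul_smul_comm, mul_smul_comm]
    refine add_mem ?_ (add_mem (N.smul_mem _ ?_) (N.smul_mem _ (N.smul_mem _ (hXX _ _ _))))
    · split_ifs
      · exact hXX _ _ _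
      · simp
    · split_ifs
      · exact hXX _ _ _
      · simp

end IsFiberMap

end AWModule

/-! ### The `gl(m,n)`-module of Whittaker vectors and the isomorphism -/

namespace AWModule

variable {M : Type*} [AddCommGroup M] [Module ℂ M] [SuperSpace M]
variable {𝓜 : AWModule m n M} {a : Fin m → ℂ} {π : M →ₗ[ℂ] M}

namespace IsFiberMap

variable (hπ : 𝓜.IsFiberMap a π)
include hπ

theorem actW_mem_gen {N : Submodule ℂ M} (hN : N ≤ 𝓜.singular a π)
    (h : ∀ i k, ∀ v ∈ N, π (𝓜.actW (field i (X k)) v) ∈ N) (D : W m n) {v : M} (hv : v ∈ N) :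
    𝓜.actW D v ∈ 𝓜.gen N := by
  rw [W_eq_sum_field D, map_sum, LinearMap.sum_apply]
  refine sum_mem fun s _ => ?_
  rw [hπ.actW_field_singular (hN hv)]
  exact add_mem (Submodule.smul_mem _ _ (actA_mem_gen _ hv))
    (sum_mem fun k _ => actA_mem_gen _ (h _ _ _ hv))

/-- The `A`-span of the singular vectors is a nonzero graded submodule, hence all of `M`; applying
`π` returns from it to the singular vectors. -/
theorem singular_eq_Wh [FiniteDimensional ℂ (𝓜.Wh a)] (ha : 𝓜.IsOfType a) (h𝓜 : 𝓜.IsSimple)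
    (h0 : 𝓜.Wh a ≠ ⊥) : 𝓜.singular a π = 𝓜.Wh a := by
  have h := h𝓜.gen_eq_top (hπ.singular_isGraded ha) (fun D v hv => hπ.actW_mem_gen le_rfl
    (fun i k v hv => hπ.singular_stable ha hv i k) D hv) (hπ.singular_ne_bot ha h0)
  refine le_antisymm singular_le_Wh fun v hv => ?_
  rw [← hπ.apply_of_mem v hv]
  refine hπ.mem_of_mem_gen singular_le_Wh ?_
  rw [h]
  trivial

/-- The `gl(m,n)`-module structure on the Whittaker vectors: a matrix acts through the linear
vector field attached to it, modulo the augmentation ideal. -/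
def glModule (ha : 𝓜.IsOfType a) : GlModule m n (𝓜.Wh a) where
  act :=
    { toFun := fun Y =>
        (π ∘ₗ 𝓜.actW (matField Y) ∘ₗ (𝓜.Wh a).subtype).codRestrict (𝓜.Wh a) fun _ => hπ.mem _
      map_add' := fun Y Z => LinearMap.ext fun v => Subtype.ext (by simp)
      map_smul' := fun c Y => LinearMap.ext fun v => Subtype.ext (by simp) }
  act_mem := fun hY hv => hπ.mem_part ha (𝓜.actW_mem (matField_mem_WPart hY) hv)
  act_sbr := by
    intro p q Y Z hY hZ
    refine LinearMap.ext fun v => Subtype.ext ?_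
    have h := 𝓜.actW_comm (matField_mem_WPart hY) (matField_mem_WPart hZ) (v : M)
    rw [← matField_sbr hY hZ] at h
    have h1 := congrArg π h
    rw [map_add, map_smul] at h1
    change π (𝓜.actW (matField (sbr p q Y Z)) v) =
      π (𝓜.actW (matField Y) (π (𝓜.actW (matField Z) v))) -
        sgn p q • π (𝓜.actW (matField Z) (π (𝓜.actW (matField Y) v)))
    -- Linear fields vanish at the origin, so the inner projections disappear and only the
    -- commutation relation in `M` is left.
    rw [hπ.actW_apply ha (eps_matField Y), hπ.actW_apply ha (eps_matField Z)]
    exact eq_sub_of_add_eq h1.symm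

theorem glModule_act_coe (ha : 𝓜.IsOfType a) (Y : Matrix (Fin m ⊕ Fin n) (Fin m ⊕ Fin n) ℂ)
    (v : 𝓜.Wh a) : ((hπ.glModule ha).act Y v : M) = π (𝓜.actW (matField Y) v) := rfl

/-- A nonzero submodule `N` consists of singular vectors, so `A N` is a submodule of `M` and equals
`M`. Projecting by `π` gives back `N` on one side and all Whittaker vectors on the other. -/
theorem glModule_isSimple (ha : 𝓜.IsOfType a) (h𝓜 : 𝓜.IsSimple) (h0 : 𝓜.Wh a ≠ ⊥)
    (hsing : 𝓜.singular a π = 𝓜.Wh a) : (hπ.glModule ha).IsSimple := by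
  refine ⟨Submodule.nontrivial_iff_ne_bot.2 h0, fun N hN hstab => ?_⟩
  by_cases hN0 : N = ⊥
  · exact Or.inl hN0
  right
  set P : Submodule ℂ M := N.map (𝓜.Wh a).subtype with hP
  have hPW : P ≤ 𝓜.Wh a := Submodule.map_subtype_le _ _
  have hPgr : IsGraded P := by
    refine le_antisymm ?_ (sup_le inf_le_left inf_le_left)
    rw [hP, Submodule.map_le_iff_le_comap]
    refine hN.le_of_hom fun p v hv hp => ?_
    have h1 : (v : M) ∈ P := Submodule.mem_map_of_mem hv
    rcases zmod_cases p with rfl | rfl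
    · exact Submodule.mem_sup_left ⟨h1, hp⟩
    · exact Submodule.mem_sup_right ⟨h1, hp⟩
  have hPstab : ∀ i k, ∀ v ∈ P, π (𝓜.actW (field i (X k)) v) ∈ P := by
    rintro i k _ ⟨v, hv, rfl⟩
    rw [← matField_single]
    exact ⟨_, hstab (Matrix.single k i 1) v hv, rfl⟩
  have hP0 : P ≠ ⊥ := fun h => hN0 ((Submodule.eq_bot_iff _).2 fun v hv =>
    Subtype.ext ((Submodule.eq_bot_iff _).1 h _ (Submodule.mem_map_of_mem hv)))
  have htop := h𝓜.gen_eq_top hPgr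
    (fun D v hv => hπ.actW_mem_gen (hPW.trans hsing.ge) hPstab D hv) hP0
  rw [eq_top_iff]
  intro v _
  have hv : π (v : M) ∈ P := hπ.mem_of_mem_gen hPW (by rw [htop]; trivial)
  rw [hπ.apply_of_mem _ v.2] at hv
  obtain ⟨w, hw, hwv⟩ := hv
  rwa [← Subtype.ext hwv]

/-- Both actions satisfy the same Leibniz rule over `A`, so it is enough to compare them on `1 ⊗ v`,
where the tensor module formula is `actW_field_singular`. -/
theorem mulMap_tensorAct (ha : 𝓜.IsOfType a) (hsing : 𝓜.singular a π = 𝓜.Wh a) (D : W m n)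
    (x : A m n ⊗[ℂ] 𝓜.Wh a) :
    𝓜.mulMap a (tensorAct a (hπ.glModule ha) D x) = 𝓜.actW D (𝓜.mulMap a x) := by
  induction D using W_induction with
  | hadd D E hD hE =>
    rw [Submodule.coe_add, map_add, LinearMap.add_apply, map_add, hD, hE, map_add,
      LinearMap.add_apply]
  | hp p D hD =>
    induction x using TensorProduct.induction_on with
    | zero => simp
    | add x y hx hy => simp only [map_add, hx, hy]
    | tmul f v =>
      have h1 : 𝓜.mulMap a (tensorAct a (hπ.glModule ha) D (1 ⊗ₜ v)) =
          𝓜.actW ⟨D, WPart_le p hD⟩ v := by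
        have hv : (v : M) ∈ 𝓜.singular a π := hsing.ge v.2
        rw [tensorAct_one_tmul _ _ hD, W_eq_sum_field ⟨D, _⟩, map_add, map_sum, map_sum,
          LinearMap.sum_apply, Finset.sum_congr rfl fun i _ => hπ.actW_field_singular hv i _]
        simp only [Finset.sum_add_distrib, map_sum, mulMap_tmul,
          glModule_act_coe, matField_single, coef_apply]
        rw [Finset.sum_comm]
        congr 1
        simp [shift_apply, chi, Fintype.sum_sum_type, LinearMap.sum_apply]
      have h2 : f ⊗ₜ[ℂ] v = f • ((1 : A m n) ⊗ₜ[ℂ] v) := by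
        rw [TensorProduct.smul_tmul', smul_eq_mul, mul_one]
      rw [h2, tensorAct_smul _ _ hD, map_add, mulMap_smul, mulMap_smul, mulMap_smul, h1,
        mulMap_tmul, map_one, Module.End.one_apply, 𝓜.actW_actA_apply hD]

theorem isIsomorphic_tensorModule (ha : 𝓜.IsOfType a) (hsing : 𝓜.singular a π = 𝓜.Wh a) :
    𝓜.IsIsomorphic (tensorModule a (hπ.glModule ha)) := by
  let e := LinearEquiv.ofBijective (𝓜.mulMap a) ⟨𝓜.mulMap_injective a, 𝓜.mulMap_surjective a ha⟩
  have he : ∀ v, 𝓜.mulMap a (e.symm v) = v := e.apply_symm_apply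
  refine ⟨e.symm, fun p v => ?_, fun f v => ?_, fun D v => ?_⟩
  · rw [mem_part_iff_of_injective (𝓜.mulMap_injective a) (fun p x hx => 𝓜.mulMap_mem a hx), he]
  · refine 𝓜.mulMap_injective a ?_
    rw [he]
    exact ((𝓜.mulMap_smul a f _).trans (congrArg _ (he v))).symm
  · refine 𝓜.mulMap_injective a ?_
    rw [he]
    exact ((hπ.mulMap_tensorAct ha hsing D _).trans (congrArg _ (he v))).symm

end IsFiberMap

/-- The Whittaker vectors generate `M` over `A`. -/
theorem Wh_ne_bot (ha : 𝓜.IsOfType a) [Nontrivial M] : 𝓜.Wh a ≠ ⊥ := by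
  intro h
  have h1 := 𝓜.gen_Wh a ha
  rw [h, gen, Submodule.map₂_bot_right] at h1
  exact bot_ne_top h1

end AWModule

end WittSuper

end

theorem theorem4p5 (m n : ℕ) (a : Fin m → ℂ)
    {M : Type u} [AddCommGroup M] [Module ℂ M] [WittSuper.SuperSpace M]
    (𝓜 : WittSuper.AWModule m n M) (hsimple : 𝓜.IsSimple) (hW : 𝓜.IsWhittaker)
    (ha : 𝓜.IsOfType a) (hfin : FiniteDimensional ℂ (𝓜.Wh a)) :
    ∃ (V : Type u) (_ : AddCommGroup V) (_ : Module ℂ V) (_ : WittSuper.SuperSpace V)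
      (ρ : WittSuper.GlModule m n V),
      FiniteDimensional ℂ V ∧ ρ.IsSimple ∧ 𝓜.IsIsomorphic (WittSuper.tensorModule a ρ) := by
  have := hsimple.1
  obtain ⟨π, hπ⟩ := 𝓜.exists_isFiberMap a ha
  have h0 := WittSuper.AWModule.Wh_ne_bot ha
  have hsing := hπ.singular_eq_Wh ha hsimple h0
  exact ⟨𝓜.Wh a, inferInstance, inferInstance, inferInstance, hπ.glModule ha, hfin,
    hπ.glModule_isSimple ha hsimple h0 hsing, hπ.isIsomorphic_tensorModule ha hsing⟩
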